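/- Let $\Lambda$ be the ring of symmetric functions with rational coefficients in infinitely many variables $\mathbf{x}=(x_1,x_2,\dots)$, i.e. the power series of bounded degree that are invariant under permutations of the variables. Let $h_n=\sum_{i_1\le\cdots\le i_n}x_{i_1}\cdots x_{i_n}$ and $e_n=\sum_{i_1<\cdots<i_n}x_{i_1}\cdots x_{i_n}$ (with $h_0=e_0=1$), and for an integer partition $\lambda$ put $e_\lambda=\prod_i e_{\lambda_i}$. For $n\ge 0$ let $\mathcal{Q}_n$ be the set of Stirling permutations: the arrangements $\theta=\theta_1\cdots\theta_{2n}$ of the multiset $\{1,1,2,2,\dots,n,n\}$ such that $i<j<k$ and $\theta_i=\theta_k=m$ imply $\theta_j\ge m$. For $a\in\{1,\dots,n\}$ let $B_\theta(a)$ be the block of $a$, that is, the segment (consecutive subword) of $\theta$ that starts and ends with the two occurrences of $a$, and let $\mathring B_\theta(a)$ be that segment without these two letters. For $a<b$ the pair $(a,b)$ is called - an AA-pair (ascending adjacent) if $\theta=\theta'B_\theta(a)B_\theta(b)\theta''$ for some words $\theta',\theta''$; - a DA-pair (descending adjacent) if $\theta=\theta'B_\theta(b)B_\theta(a)\theta''$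 for some words $\theta',\theta''$; - a TN-pair (terminally nested) if $\mathring B_\theta(a)=\theta'B_\theta(b)$ for some word $\theta'$; - an IN-pair (initially nested) if $\mathring B_\theta(a)=B_\theta(b)\theta'$ for some word $\theta'$. For $K\in\{\mathrm{AA},\mathrm{DA},\mathrm{TN},\mathrm{IN}\}$, a $K$-sequence of $\theta$ of length $k\ge1$ is a sequence $a_1<\cdots<a_k$ in $\{1,\dots,n\}$ such that $(a_j,a_{j+1})$ is a $K$-pair for $1\le j<k$, and the type $\lambda^{K}(\theta)$ is the partition whose parts are the lengths of the maximal $K$-sequences of $\theta$. **Theorem.** For each $K\in\{\mathrm{AA},\mathrm{DA},\mathrm{TN},\mathrm{IN}\}$, in $\Lambda[[y]]$, $$\left(\sum_{n\ge1}(-1)^{n-1}h_{n-1}(\mathbf{x})\frac{y^n}{n!}\right)^{\langle -1\rangle}=\sum_{n\ge1}\left(\sum_{\theta\in\mathcal{Q}_{n-1}}e_{\lambda^{K}(\theta)}(\mathbf{x})\right)\frac{y^n}{n!},$$ where $\langle -1\rangle$ denotes the compositional (two-sided) inverse of a power series in $y$ without constant term. -/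

import Mathlib

namespace StirlingSym

/-! ### Symmetric functions in infinitely many variables over `ℚ` -/

/-- The ring `Λ` of symmetric functions with rational coefficients: the power series in the
variables `x_i` (`i : ℕ`) of bounded degree that are invariant under all permutations of the
variables. -/
noncomputable def Lam : Subalgebra ℚ (MvPowerSeries ℕ ℚ) where
  carrier := {f | (∃ d : ℕ, ∀ μ : ℕ →₀ ℕ, MvPowerSeries.coeff μ f ≠ 0 → μ.degree ≤ d) ∧
    ∀ σ : Equiv.Perm ℕ, MvPowerSeries.renameEquiv ℚ σ f = f}
  mul_mem' := by
    classical
    rintro f g ⟨⟨a, ha⟩, hf⟩ ⟨⟨b, hb⟩, hg⟩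
    refine ⟨⟨a + b, fun μ hμ => ?_⟩, fun σ => by rw [map_mul, hf, hg]⟩
    rw [MvPowerSeries.coeff_mul] at hμ
    obtain ⟨p, hp, hne⟩ := Finset.exists_ne_zero_of_sum_ne_zero hμ
    have h1 := ha p.1 (left_ne_zero_of_mul hne)
    have h2 := hb p.2 (right_ne_zero_of_mul hne)
    rw [Finset.HasAntidiagonal.mem_antidiagonal] at hp
    rw [← hp, map_add]
    omega
  add_mem' := by
    rintro f g ⟨⟨a, ha⟩, hf⟩ ⟨⟨b, hb⟩, hg⟩
    refine ⟨⟨a + b, fun μ hμ => ?_⟩, fun σ => by rw [map_add, hf, hg]⟩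
    by_contra hcon
    apply hμ
    have h1 : MvPowerSeries.coeff μ f = 0 := by
      by_contra h
      have := ha μ h
      omega
    have h2 : MvPowerSeries.coeff μ g = 0 := by
      by_contra h
      have := hb μ h
      omega
    rw [map_add, h1, h2, add_zero]
  algebraMap_mem' := by
    classical
    intro r
    refine ⟨⟨0, fun μ hμ => ?_⟩, fun σ => AlgEquiv.commutes _ r⟩
    rw [MvPowerSeries.algebraMap_apply, MvPowerSeries.coeff_C] at hμ
    by_contra hcon
    apply hμ
    rw [if_neg]
    rintro rfl
    simp at hcon

/-- A power series all of whose monomials have degree `n` and whose coefficients are given by a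
permutation-invariant function of the exponent vector is a symmetric function. -/
theorem mem_Lam_of_invariant (n : ℕ) (c : (ℕ →₀ ℕ) → ℚ) (h0 : ∀ μ, c μ ≠ 0 → μ.degree = n)
    (hc : ∀ (σ : Equiv.Perm ℕ) (μ : ℕ →₀ ℕ), c (μ.mapDomain σ) = c μ) :
    (c : MvPowerSeries ℕ ℚ) ∈ Lam := by
  refine ⟨⟨n, fun μ hμ => (h0 μ hμ).le⟩, fun σ => ?_⟩
  ext x
  obtain ⟨y, rfl⟩ : ∃ y : ℕ →₀ ℕ, y.embDomain σ.toEmbedding = x := by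
    refine ⟨x.mapDomain σ.symm, ?_⟩
    rw [Finsupp.embDomain_eq_mapDomain, Equiv.coe_toEmbedding, ← Finsupp.mapDomain_comp]
    simp
  refine (MvPowerSeries.coeff_embDomain_rename σ.toEmbedding c y).trans ?_
  rw [Finsupp.embDomain_eq_mapDomain]
  exact (hc σ y).symm

open Classical in
/-- The complete homogeneous symmetric function `h_n`, the sum of `x_{i_1} ⋯ x_{i_n}` over
`i_1 ≤ ⋯ ≤ i_n`: every monomial `x^μ` of degree `n` occurs exactly once. -/
noncomputable def h (n : ℕ) : Lam :=
  ⟨fun μ => if μ.degree = n then 1 else 0, by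
    refine mem_Lam_of_invariant n _ (fun μ hμ => ?_) (fun σ μ => ?_)
    · by_contra hcon
      exact hμ (if_neg hcon)
    · rw [Finsupp.degree_mapDomain]⟩

open Classical in
/-- The elementary symmetric function `e_n`, the sum of `x_{i_1} ⋯ x_{i_n}` over
`i_1 < ⋯ < i_n`: every square-free monomial `x^μ` of degree `n` occurs exactly once. -/
noncomputable def e (n : ℕ) : Lam :=
  ⟨fun μ => if μ.degree = n ∧ ∀ i, μ i ≤ 1 then 1 else 0, by
    refine mem_Lam_of_invariant n _ (fun μ hμ => ?_) (fun σ μ => ?_)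
    · by_contra hcon
      exact hμ (if_neg fun hh => hcon hh.1)
    · have key : (∀ i, μ.mapDomain σ i ≤ 1) ↔ ∀ i, μ i ≤ 1 := by
        rw [← σ.forall_congr_right]
        simp only [Finsupp.mapDomain_apply σ.injective]
      rw [Finsupp.degree_mapDomain, key]⟩

/-- `e_lam = ∏ e_{lam_i}`, for a partition given by the multiset of its parts. -/
noncomputable def ePart (lam : Multiset ℕ) : Lam := (lam.map e).prod

/-! ### Stirling permutations and their types -/

/-- `Q n`: the arrangements `θ` of the multiset `{1,1,2,2,…,n,n}` such that `i < j < k` and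
`θ_i = θ_k = m` imply `θ_j ≥ m`. -/
def Q (n : ℕ) : Finset (List ℕ) :=
  ((Finset.Icc 1 n).val + (Finset.Icc 1 n).val).lists.toFinset.filter fun θ =>
    ∀ i j k : Fin θ.length, i < j → j < k → θ.get i = θ.get k → θ.get k ≤ θ.get j

/-- The word `a w a`. When a letter `a` occurs exactly twice in `θ`, the block `B_θ(a)` is the only
segment of `θ` of this form, and `w` is its interior. -/
def block (a : ℕ) (w : List ℕ) : List ℕ := a :: (w ++ [a])

/-- `(a, b)` is an ascending adjacent pair of `θ`: `a < b` and `θ = θ' B(a) B(b) θ''`. -/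
def IsAAPair (θ : List ℕ) (a b : ℕ) : Prop :=
  a < b ∧ ∃ p u v q : List ℕ, θ = p ++ block a u ++ block b v ++ q

/-- `(a, b)` is a descending adjacent pair of `θ`: `a < b` and `θ = θ' B(b) B(a) θ''`. -/
def IsDAPair (θ : List ℕ) (a b : ℕ) : Prop :=
  a < b ∧ ∃ p u v q : List ℕ, θ = p ++ block b v ++ block a u ++ q

/-- `(a, b)` is a terminally nested pair of `θ`: `a < b` and `B(b)` is the last block in the
interior of `B(a)`. -/
def IsTNPair (θ : List ℕ) (a b : ℕ) : Prop :=
  a < b ∧ ∃ p u v q : List ℕ, θ = p ++ block a (u ++ block b v) ++ q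

/-- `(a, b)` is an initially nested pair of `θ`: `a < b` and `B(b)` is the first block in the
interior of `B(a)`. -/
def IsINPair (θ : List ℕ) (a b : ℕ) : Prop :=
  a < b ∧ ∃ p u v q : List ℕ, θ = p ++ block a (block b v ++ u) ++ q

/-- The four kinds of types: ascending adjacent, descending adjacent, terminally nested and
initially nested. -/
inductive Kind where
  | AA
  | DA
  | TN
  | IN

/-- The pairs of the given kind. -/
def IsPair : Kind → List ℕ → ℕ → ℕ → Prop
  | Kind.AA => IsAAPair
  | Kind.DA => IsDAPair
  | Kind.TN => IsTNPair
  | Kind.IN => IsINPair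

/-- A sequence `a_1 < ⋯ < a_k` (`k ≥ 1`) of letters in `[n]` all of whose consecutive pairs
`(a_j, a_{j+1})` are pairs of `θ` of the given kind, encoded as the finite set of its entries. -/
def IsSeq (K : Kind) (n : ℕ) (θ : List ℕ) (s : Finset ℕ) : Prop :=
  s.Nonempty ∧ s ⊆ Finset.Icc 1 n ∧ (s.sort (· ≤ ·)).IsChain (IsPair K θ)

open Classical in
/-- The type of `θ ∈ Q n` of the given kind: the multiset of the lengths of the maximal sequences
of that kind. -/
noncomputable def type (K : Kind) (n : ℕ) (θ : List ℕ) : Multiset ℕ :=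
  ((Finset.Icc 1 n).powerset.filter fun s => Maximal (IsSeq K n θ) s).val.map Finset.card

/-! ### The generating functions -/

/-- The exponential generating function `∑_{n ≥ 1} (-1)^(n-1) h_{n-1} y^n / n!` in `Λ[[y]]`. -/
noncomputable def hSeries : PowerSeries Lam :=
  PowerSeries.mk fun n =>
    if n = 0 then 0 else ((n.factorial : ℚ)⁻¹) • ((-1) ^ (n - 1) * h (n - 1))

/-- The exponential generating function `∑_{n ≥ 1} (∑_{θ ∈ Q (n-1)} e_{λ(θ)}) y^n / n!` in
`Λ[[y]]`, where `λ` is the type of the given kind. -/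
noncomputable def stirlingSeries (K : Kind) : PowerSeries Lam :=
  PowerSeries.mk fun n =>
    if n = 0 then 0
    else ((n.factorial : ℚ)⁻¹) • ∑ θ ∈ Q (n - 1), ePart (type K (n - 1) θ)

/-- `G` is the compositional inverse of `F`: neither has a constant term, and
`F(G(y)) = y = G(F(y))`. -/
def IsCompInverse {R : Type*} [CommRing R] (F G : PowerSeries R) : Prop :=
  PowerSeries.constantCoeff F = 0 ∧ PowerSeries.constantCoeff G = 0 ∧
    PowerSeries.subst G F = PowerSeries.X ∧ PowerSeries.subst F G = PowerSeries.X

end StirlingSym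

/-! Both series are governed by one derivation `D` (`growth`). It lives on a polynomial ring in free
variables `e_k`, where its values on generators can be prescribed; the result is specialized to `Λ`
at the end.

Combinatorics: removing the two adjacent copies of the largest letter from a word of `Q (n+1)`
leaves a word of `Q n` with one of `2n+1` gaps marked. Reversal reduces DA to AA and TN to IN. AA-
and IN-pairs both say that a specified occurrence of `a` (second or first) is followed immediately
by the first `b`. Exactly `n` gaps follow a specified occurrence, one for each letter `x`. Inserting
there cuts the chain of `x` after `x` and appends the new letter to the lower part, so `e_k` becomes
`e_{j+2} e_{k-j-1}`. Each of the other `n+1` gaps adds a singleton chain. Hence `Φ_{n+1} = (n+1) e_1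
Φ_n + D Φ_n` with `D e_k = ∑_{j<k} e_{j+2} e_{k-j-1}` (`sum_chainWeight_insertTwice`).

Algebra: write `H_n = (-1)^n h_n`. The relation `E H = 1` yields `D H_n = e_1 H_n + H_{n+1}`
(`growth_genericH`). For the two series this means `D F = e_1 F + F' - 1` and `G' (1 - e_1 y) = 1 +
D G`. The chain rule makes `V = G(F)` satisfy `D V = V' - 1`, whose only solution without constant
term is `y`. -/

namespace StirlingSym

/-! ### Coefficientwise derivations of power series -/

section Coefficientwise

open PowerSeries

variable {A R : Type*} [CommRing A] [CommRing R] [Algebra A R]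

/-- The derivation of `R⟦X⟧` that applies a derivation of `R` to every coefficient. -/
noncomputable def coeffDerivation (D : Derivation A R R) : Derivation A R⟦X⟧ R⟦X⟧ :=
  Derivation.mk'
    { toFun := fun f => PowerSeries.mk fun n => D (coeff n f)
      map_add' := fun f g => by ext n; simp
      map_smul' := fun a f => by ext n; simp }
    (fun f g => by
      ext n
      simp only [LinearMap.coe_mk, AddHom.coe_mk, coeff_mk, smul_eq_mul, map_add, coeff_mul,
        map_sum, Derivation.leibniz, Finset.sum_add_distrib]
      congr 1
      exact Finset.Nat.sum_antidiagonal_swap (f := fun p => coeff p.1 g * D (coeff p.2 f)))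

theorem coeff_coeffDerivation (D : Derivation A R R) (f : R⟦X⟧) (n : ℕ) :
    coeff n (coeffDerivation D f) = D (coeff n f) := by
  simp [coeffDerivation]

theorem coeffDerivation_X (D : Derivation A R R) : coeffDerivation D (X : R⟦X⟧) = 0 := by
  ext n
  rw [coeff_coeffDerivation, coeff_X]
  split_ifs <;> simp

theorem coeffDerivation_C (D : Derivation A R R) (a : R) :
    coeffDerivation D (C a) = C (D a) := by
  ext n
  rw [coeff_coeffDerivation, coeff_C, coeff_C]
  split_ifs <;> simp

/-- The chain rule for a derivation of the coefficients. -/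
theorem coeffDerivation_subst (D : Derivation A R R) {g : R⟦X⟧} (hg : constantCoeff g = 0)
    (f : R⟦X⟧) :
    coeffDerivation D (f.subst g) =
      (coeffDerivation D f).subst g + (derivative R f).subst g * coeffDerivation D g := by
  have hs : HasSubst g := HasSubst.of_constantCoeff_zero' hg
  -- `E f` is the defect of the chain rule. Writing `f = X f₁ + c` gives `E f = g * E f₁`;
  -- iterating, every power of `X` divides `E f`.
  set E : R⟦X⟧ → R⟦X⟧ := fun f => coeffDerivation D (f.subst g) -
    ((coeffDerivation D f).subst g + (derivative R f).subst g * coeffDerivation D g) with hE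
  have step : ∀ f : R⟦X⟧, ∃ f₁, E f = g * E f₁ := by
    intro f
    refine ⟨PowerSeries.mk fun n => coeff (n + 1) f, ?_⟩
    set f₁ : R⟦X⟧ := PowerSeries.mk fun n => coeff (n + 1) f
    have hf : f = X * f₁ + C (constantCoeff f) := eq_X_mul_shift_add_const f
    have h1 : (C (constantCoeff f) : R⟦X⟧).subst g = C (constantCoeff f) := subst_C _
    have h2 : (C (D (constantCoeff f)) : R⟦X⟧).subst g = C (D (constantCoeff f)) := subst_C _
    rw [hf]
    simp only [hE, subst_add hs, subst_mul hs, subst_X hs, map_add, Derivation.leibniz, h1, h2,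
      coeffDerivation_X, coeffDerivation_C, smul_eq_mul, derivative_X, derivative_C, mul_zero,
      add_zero, mul_one]
    ring
  have dvd : ∀ n (f : R⟦X⟧), X ^ n ∣ E f := by
    intro n
    induction n with
    | zero => simp
    | succ n ih =>
      intro f
      obtain ⟨f₁, h₁⟩ := step f
      rw [h₁, pow_succ']
      exact mul_dvd_mul (X_dvd_iff.2 hg) (ih f₁)
  have hzero : E f = 0 := by
    ext n
    exact X_pow_dvd_iff.1 (dvd (n + 1) f) n n.lt_succ_self
  exact sub_eq_zero.1 hzero

end Coefficientwise

/-! ### The universal identity -/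

section Universal

open PowerSeries

variable {R : Type*} [CommRing R] [Algebra ℚ R]

/-- The equation reads `D V_n = (n+1) V_{n+1} - [n = 0]`, so each coefficient determines the next
one, `n + 1` being invertible. -/
theorem eq_X_of_coeffDerivation_eq (D : Derivation ℚ R R) {V : R⟦X⟧}
    (h0 : constantCoeff V = 0) (hV : coeffDerivation D V = derivative R V - 1) : V = X := by
  have key : ∀ n, coeff n V = coeff n (X : R⟦X⟧) := by
    intro n
    induction n with
    | zero => simpa using h0
    | succ n ih =>
      have h := congrArg (coeff n) hV
      rw [coeff_coeffDerivation, ih, map_sub, coeff_derivative] at h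
      have hl : D (coeff n (X : R⟦X⟧)) = 0 := by
        rw [coeff_X]; split_ifs <;> simp
      rw [hl, eq_comm, sub_eq_zero] at h
      have hu : IsUnit ((n : R) + 1) := by
        have : IsUnit ((n : ℚ) + 1) := (Nat.cast_add_one_ne_zero n).isUnit
        simpa using this.map (algebraMap ℚ R)
      refine hu.mul_right_cancel (h.trans ?_)
      rw [coeff_one, coeff_X]
      by_cases hn : n = 0 <;> simp [hn]
  ext n
  exact key n

/-- If the coefficients satisfy the differential equations below, then the two series are
inverse to each other under composition. -/
theorem isCompInverse_of_coeffDerivation (D : Derivation ℚ R R) (a : R) {F G : R⟦X⟧}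
    (hF : constantCoeff F = 0) (hG : constantCoeff G = 0) (hF1 : coeff 1 F = 1)
    (hDF : coeffDerivation D F = C a * F + derivative R F - 1)
    (hDG : derivative R G * (1 - C a * X) = 1 + coeffDerivation D G) :
    IsCompInverse F G := by
  have hsF : HasSubst F := HasSubst.of_constantCoeff_zero' hF
  have hGF : G.subst F = X := by
    refine eq_X_of_coeffDerivation_eq D (constantCoeff_subst_eq_zero hF G hG) ?_
    have h1 := congrArg (subst F) hDG
    have hC : (C a : R⟦X⟧).subst F = C a := subst_C _
    have hone : (1 : R⟦X⟧).subst F = 1 := by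
      simpa using (subst_C (1 : R) : (C (1 : R) : R⟦X⟧).subst F = _)
    rw [subst_mul hsF, subst_sub hsF, subst_mul hsF, subst_add hsF, subst_X hsF, hC, hone] at h1
    rw [coeffDerivation_subst D hF, derivative_subst hsF, hDF]
    linear_combination -h1
  have hu : IsUnit (coeff 1 F) := by rw [hF1]; exact isUnit_one
  refine ⟨hF, hG, ?_, hGF⟩
  -- The linear coefficient of `F` is a unit, so `F` has a right inverse, with which the left
  -- inverse `G` must coincide.
  have hS : G = F.substInvOfIsUnit hu := by
    have h2 := congrArg (subst (F.substInvOfIsUnit hu)) hGF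
    rw [subst_comp_subst_apply hsF (HasSubst.substInvOfIsUnit F hu),
      subst_X (HasSubst.substInvOfIsUnit F hu), subst_substInvOfIsUnit_right F hF hu] at h2
    simpa using h2
  rw [hS]
  exact subst_substInvOfIsUnit_right F hF hu

end Universal

/-! ### The generic ring and the growth derivation -/

section Generic

open PowerSeries

/-- The generic elementary symmetric functions, with `genericE 0 = 1`. -/
noncomputable def genericE (k : ℕ) : MvPolynomial ℕ ℚ := if k = 0 then 1 else MvPolynomial.X k

theorem genericE_zero : genericE 0 = 1 := if_pos rfl

/-- The generating series of the signed generic complete symmetric functions. -/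
noncomputable def genericHSeries : (MvPolynomial ℕ ℚ)⟦X⟧ := invOfUnit (PowerSeries.mk genericE) 1

theorem genericE_mul_genericHSeries : PowerSeries.mk genericE * genericHSeries = 1 :=
  mul_invOfUnit _ _ (by simp [← coeff_zero_eq_constantCoeff_apply, genericE_zero])

/-- The signed generic complete symmetric functions `(-1)^n h_n`. -/
noncomputable def genericH (n : ℕ) : MvPolynomial ℕ ℚ := coeff n genericHSeries

theorem genericH_zero : genericH 0 = 1 := by
  have h := congrArg (coeff 0) genericE_mul_genericHSeries
  rw [coeff_mul, Finset.HasAntidiagonal.antidiagonal_zero, Finset.sum_singleton, coeff_mk, genericE_zero, one_mul,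
    coeff_zero_one] at h
  exact h

/-- The derivation describing the growth of one chain by a new largest element. -/
noncomputable def growth : Derivation ℚ (MvPolynomial ℕ ℚ) (MvPolynomial ℕ ℚ) :=
  MvPolynomial.mkDerivation ℚ fun k =>
    ∑ j ∈ Finset.range k, genericE (j + 2) * genericE (k - (j + 1))

theorem growth_genericE (k : ℕ) :
    growth (genericE k) = ∑ j ∈ Finset.range k, genericE (j + 2) * genericE (k - (j + 1)) := by
  rcases Nat.eq_zero_or_pos k with rfl | hk
  · simp [genericE_zero]
  · conv_lhs => rw [genericE, if_neg hk.ne']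
    rw [growth, MvPolynomial.mkDerivation_X]

/-- The sum defining `growth` is a Cauchy product shifted by one degree. -/
theorem coeffDerivation_growth_genericE :
    coeffDerivation growth (PowerSeries.mk genericE) =
      X * ((PowerSeries.mk fun n => genericE (n + 2)) * PowerSeries.mk genericE) := by
  ext1 n
  rw [coeff_coeffDerivation, coeff_mk, growth_genericE]
  cases n with
  | zero => simp
  | succ n =>
    rw [coeff_succ_X_mul, coeff_mul, Finset.Nat.sum_antidiagonal_eq_sum_range_succ_mk]
    refine Finset.sum_congr rfl fun j _ => ?_
    rw [coeff_mk, coeff_mk, Nat.add_sub_add_right]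

/-- With `D E = X T E`, differentiating `E H = 1` gives `D H = -X T H`. Multiplying by `X` allows
`X² T` to be replaced by `E - 1 - e_1 X`. -/
theorem growth_genericH (n : ℕ) :
    growth (genericH n) = genericE 1 * genericH n + genericH (n + 1) := by
  set E : (MvPolynomial ℕ ℚ)⟦X⟧ := PowerSeries.mk genericE with hE
  set T : (MvPolynomial ℕ ℚ)⟦X⟧ := PowerSeries.mk fun n => genericE (n + 2) with hT
  set H := genericHSeries with hH
  have hEH : E * H = 1 := genericE_mul_genericHSeries
  have hET : E = 1 + C (genericE 1) * X + X * (X * T) := by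
    ext1 k
    rcases k with _ | _ | k
    · simp [hE, genericE_zero]
    · simp [hE, coeff_one, coeff_succ_X_mul]
    · simp [hE, hT, coeff_one, coeff_succ_X_mul]
  have h1 : coeffDerivation growth (E * H) = 0 := by rw [hEH, Derivation.map_one_eq_zero]
  rw [Derivation.leibniz, coeffDerivation_growth_genericE, smul_eq_mul, smul_eq_mul] at h1
  have h2 : X * coeffDerivation growth H = H - 1 + X * (C (genericE 1) * H) := by
    linear_combination (X * H) * h1 - (X * X * T * H + X * coeffDerivation growth H + 1) * hEH +
      H * hET
  have h3 := congrArg (coeff (n + 1)) h2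
  rw [coeff_succ_X_mul, coeff_coeffDerivation, map_add, map_sub, coeff_succ_X_mul, coeff_C_mul,
    coeff_one, if_neg n.succ_ne_zero, sub_zero] at h3
  rw [genericH, h3, genericH, add_comm]

theorem rat_factorial_inv_smul_eq {R : Type*} [CommRing R] [Algebra ℚ R] (n : ℕ) (a : R) :
    (((n + 1).factorial : ℚ)⁻¹ • a) * ((n : R) + 1) = ((n.factorial : ℚ)⁻¹) • a := by
  have h : ((n : R) + 1) = algebraMap ℚ R ((n : ℚ) + 1) := by simp
  rw [h, mul_comm, ← Algebra.smul_def, smul_smul, Nat.factorial_succ]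
  congr 1
  push_cast
  have h1 : (n : ℚ) + 1 ≠ 0 := Nat.cast_add_one_ne_zero n
  have h2 : (n.factorial : ℚ) ≠ 0 := Nat.cast_ne_zero.2 n.factorial_ne_zero
  field_simp

/-- The exponential generating series `∑_{n ≥ 1} a_{n-1} y^n / n!`. -/
noncomputable def shiftedEgf {R : Type*} [CommRing R] [Algebra ℚ R] (a : ℕ → R) : R⟦X⟧ :=
  PowerSeries.mk fun n => if n = 0 then 0 else ((n.factorial : ℚ)⁻¹) • a (n - 1)

section ShiftedEgf

variable {R : Type*} [CommRing R] [Algebra ℚ R] (a : ℕ → R)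

theorem coeff_zero_shiftedEgf : coeff 0 (shiftedEgf a) = 0 := by simp [shiftedEgf]

theorem coeff_succ_shiftedEgf (n : ℕ) :
    coeff (n + 1) (shiftedEgf a) = (((n + 1).factorial : ℚ)⁻¹) • a n := by simp [shiftedEgf]

theorem constantCoeff_shiftedEgf : constantCoeff (shiftedEgf a) = 0 := by
  rw [← coeff_zero_eq_constantCoeff_apply, coeff_zero_shiftedEgf]

theorem coeff_derivative_shiftedEgf (n : ℕ) :
    coeff n (derivative R (shiftedEgf a)) = ((n.factorial : ℚ)⁻¹) • a n := by
  rw [coeff_derivative, coeff_succ_shiftedEgf, rat_factorial_inv_smul_eq]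

theorem map_shiftedEgf {S : Type*} [CommRing S] [Algebra ℚ S] (φ : R →ₐ[ℚ] S) :
    (shiftedEgf a).map (φ : R →+* S) = shiftedEgf fun n => φ (a n) := by
  ext n
  simp only [shiftedEgf, coeff_map, coeff_mk]
  split_ifs <;> simp

end ShiftedEgf

/-- Multiplied by `1/(n+1)!`, the recurrence `hs` is the coefficient form of `G' (1 - e_1 y) = 1 + D
G`; `growth_genericH` gives the equation for `F`. -/
theorem isCompInverse_generic {Φ : ℕ → MvPolynomial ℕ ℚ} (h0 : Φ 0 = 1)
    (hs : ∀ n : ℕ, Φ (n + 1) = (n + 1) * genericE 1 * Φ n + growth (Φ n)) :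
    IsCompInverse (shiftedEgf genericH) (shiftedEgf Φ) := by
  refine isCompInverse_of_coeffDerivation growth (genericE 1) (constantCoeff_shiftedEgf _)
    (constantCoeff_shiftedEgf _) ?_ ?_ ?_
  · simpa [genericH_zero] using coeff_succ_shiftedEgf genericH 0
  · ext1 n
    rw [coeff_coeffDerivation, map_sub, map_add, coeff_derivative_shiftedEgf, coeff_C_mul]
    cases n with
    | zero => simp [coeff_zero_shiftedEgf, genericH_zero]
    | succ n =>
      rw [coeff_succ_shiftedEgf, growth.map_smul, growth_genericH, coeff_one, if_neg n.succ_ne_zero,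
        smul_add, mul_smul_comm, sub_zero]
  · ext1 n
    rw [mul_sub, mul_one, map_sub, map_add, coeff_coeffDerivation, coeff_derivative_shiftedEgf]
    cases n with
    | zero => simp [coeff_zero_shiftedEgf, h0]
    | succ n =>
      rw [← mul_assoc, coeff_succ_mul_X, coeff_mul_C, coeff_derivative_shiftedEgf,
        coeff_succ_shiftedEgf, growth.map_smul, coeff_one, if_neg n.succ_ne_zero, zero_add, hs,
        ← rat_factorial_inv_smul_eq n (Φ n), smul_add]
      simp only [Algebra.smul_def]
      ring

end Generic

section Transport

open PowerSeries

variable {R S : Type*} [CommRing R] [CommRing S]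

theorem IsCompInverse.map (φ : R →+* S) {F G : R⟦X⟧} (hFG : IsCompInverse F G) :
    IsCompInverse (F.map φ) (G.map φ) := by
  obtain ⟨hF, hG, h1, h2⟩ := hFG
  refine ⟨?_, ?_, ?_, ?_⟩
  · rw [← coeff_zero_eq_constantCoeff_apply, coeff_map, coeff_zero_eq_constantCoeff_apply, hF,
      map_zero]
  · rw [← coeff_zero_eq_constantCoeff_apply, coeff_map, coeff_zero_eq_constantCoeff_apply, hG,
      map_zero]
  · have h := congrArg (PowerSeries.map φ) h1
    rw [PowerSeries.map_X] at h
    exact (PowerSeries.map_subst (HasSubst.of_constantCoeff_zero' hG) _).symm.trans h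
  · have h := congrArg (PowerSeries.map φ) h2
    rw [PowerSeries.map_X] at h
    exact (PowerSeries.map_subst (HasSubst.of_constantCoeff_zero' hF) _).symm.trans h

end Transport

/-! ### The relation between the elementary and the complete symmetric functions -/

open Classical in
-- A square-free divisor of `x^μ` is a subset of the support of `μ`, and the alternating sum over
-- subsets vanishes unless the support is empty. The global sign `(-1)^|μ|` matters only for `μ =
-- 0`, where it is `1`.
theorem sum_antidiagonal_squarefree_neg_one_pow (μ : ℕ →₀ ℕ) :
    (∑ p ∈ Finset.HasAntidiagonal.antidiagonal μ, if ∀ i, p.1 i ≤ 1 then (-1 : ℚ) ^ p.2.degree else 0) =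
      if μ = 0 then 1 else 0 := by
  classical
  have key : (∑ s ∈ μ.support.powerset, (-1 : ℚ) ^ s.card) = if μ = 0 then 1 else 0 := by
    have h := Finset.sum_powerset_neg_one_pow_card (x := μ.support)
    have h' := congrArg (Int.cast : ℤ → ℚ) h
    push_cast at h'
    simpa [Finsupp.support_eq_empty] using h'
  have key2 : (-1 : ℚ) ^ μ.degree * (if μ = 0 then 1 else 0) = if μ = 0 then 1 else 0 := by
    split_ifs with hμ
    · simp [hμ]
    · simp
  rw [← key2, ← key, Finset.mul_sum, ← Finset.sum_filter]
  have hval : ∀ (s : Finset ℕ) (i : ℕ),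
      Finsupp.indicator s (fun _ _ => 1) i = if i ∈ s then 1 else 0 := by
    intro s i; simp [Finsupp.indicator_apply]
  refine Finset.sum_nbij' (fun p => p.1.support)
    (fun s => (Finsupp.indicator s (fun _ _ => 1), μ - Finsupp.indicator s (fun _ _ => 1)))
    ?_ ?_ ?_ ?_ ?_
  · intro p hp
    rw [Finset.mem_filter, Finset.HasAntidiagonal.mem_antidiagonal] at hp
    rw [Finset.mem_powerset, ← hp.1]
    intro i hi
    rw [Finsupp.mem_support_iff] at hi ⊢
    rw [Finsupp.add_apply]
    omega
  · intro s hs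
    rw [Finset.mem_powerset] at hs
    rw [Finset.mem_filter, Finset.HasAntidiagonal.mem_antidiagonal]
    refine ⟨?_, fun i => ?_⟩
    · ext i
      have hi : i ∈ s → μ i ≠ 0 := fun hi => Finsupp.mem_support_iff.1 (hs hi)
      rw [Finsupp.add_apply, Finsupp.tsub_apply, hval]
      split_ifs with h
      · have := hi h
        omega
      · omega
    · dsimp only
      rw [hval]
      split_ifs <;> simp
  · intro p hp
    rw [Finset.mem_filter, Finset.HasAntidiagonal.mem_antidiagonal] at hp
    have h1 : Finsupp.indicator p.1.support (fun _ _ => 1) = p.1 := by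
      ext i
      have := hp.2 i
      rw [hval]
      split_ifs with h
      · rw [Finsupp.mem_support_iff] at h
        omega
      · rw [Finsupp.notMem_support_iff] at h
        omega
    rw [h1]
    refine Prod.ext rfl ?_
    rw [← hp.1, add_tsub_cancel_left]
  · intro s hs
    ext i
    rw [Finsupp.mem_support_iff, hval]
    simp
  · intro p hp
    rw [Finset.mem_filter, Finset.HasAntidiagonal.mem_antidiagonal] at hp
    have h1 : p.1.degree = p.1.support.card := by
      rw [Finsupp.degree_apply, Finset.card_eq_sum_ones]
      refine Finset.sum_congr rfl fun i hi => ?_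
      have := hp.2 i
      rw [Finsupp.mem_support_iff] at hi
      omega
    rw [← hp.1, map_add, h1, pow_add, mul_right_comm, ← pow_add, ← two_mul, pow_mul]
    simp

open PowerSeries in
theorem e_mul_h : (PowerSeries.mk e) * (PowerSeries.mk fun n => (-1) ^ n * h n) = 1 := by
  classical
  ext1 n
  rw [coeff_mul]
  simp only [coeff_mk]
  refine Subtype.ext ?_
  ext μ
  have hcoe : ((∑ p ∈ Finset.HasAntidiagonal.antidiagonal n, e p.1 * ((-1) ^ p.2 * h p.2) : Lam) :
      MvPowerSeries ℕ ℚ) =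
      ∑ p ∈ Finset.HasAntidiagonal.antidiagonal n, (-1 : ℚ) ^ p.2 • ((e p.1 : MvPowerSeries ℕ ℚ) * (h p.2 : MvPowerSeries ℕ ℚ)) := by
    rw [AddSubmonoidClass.coe_finsetSum]
    refine Finset.sum_congr rfl fun p _ => ?_
    push_cast
    rw [Algebra.smul_def, map_pow, map_neg, map_one, mul_left_comm]
  have hterm : ∀ p ∈ Finset.HasAntidiagonal.antidiagonal n,
      MvPowerSeries.coeff μ ((-1 : ℚ) ^ p.2 • ((e p.1 : MvPowerSeries ℕ ℚ) * (h p.2 : MvPowerSeries ℕ ℚ))) =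
        ∑ q ∈ Finset.HasAntidiagonal.antidiagonal μ, if (q.1.degree, q.2.degree) = p then
          (if ∀ i, q.1 i ≤ 1 then (-1 : ℚ) ^ q.2.degree else 0) else 0 := by
    intro p _
    rw [MvPowerSeries.coeff_smul, MvPowerSeries.coeff_mul, Finset.mul_sum]
    refine Finset.sum_congr rfl fun q _ => ?_
    have he : MvPowerSeries.coeff q.1 (e p.1 : MvPowerSeries ℕ ℚ) =
        if q.1.degree = p.1 ∧ ∀ i, q.1 i ≤ 1 then 1 else 0 := by
      simp only [e]; rfl
    have hh : MvPowerSeries.coeff q.2 (h p.2 : MvPowerSeries ℕ ℚ) =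
        if q.2.degree = p.2 then 1 else 0 := by
      simp only [h]; rfl
    rw [he, hh]
    by_cases h1 : q.1.degree = p.1 <;> by_cases h2 : q.2.degree = p.2 <;>
      by_cases h3 : ∀ i, q.1 i ≤ 1 <;> simp [h1, h2, h3, Prod.ext_iff]
  have hone : MvPowerSeries.coeff μ ((coeff n (1 : PowerSeries Lam) : Lam) : MvPowerSeries ℕ ℚ) =
      if n = 0 ∧ μ = 0 then 1 else 0 := by
    rw [coeff_one]
    split_ifs with h1 h2 h2 <;> simp_all [MvPowerSeries.coeff_one]
  -- After exchanging the sums, each factorization of `x^μ` lies in just one pair of degrees, so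
  -- only `n = deg μ` contributes.
  rw [hcoe, map_sum, Finset.sum_congr rfl hterm, Finset.sum_comm, hone]
  have hinner : ∀ q ∈ Finset.HasAntidiagonal.antidiagonal μ,
      (∑ p ∈ Finset.HasAntidiagonal.antidiagonal n, if (q.1.degree, q.2.degree) = p then
          (if ∀ i, q.1 i ≤ 1 then (-1 : ℚ) ^ q.2.degree else 0) else 0) =
        if μ.degree = n then (if ∀ i, q.1 i ≤ 1 then (-1 : ℚ) ^ q.2.degree else 0) else 0 := by
    intro q hq
    rw [Finset.sum_ite_eq]
    simp only [Finset.HasAntidiagonal.mem_antidiagonal, ← map_add,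
      Finset.HasAntidiagonal.mem_antidiagonal.1 hq]
  rw [Finset.sum_congr rfl hinner]
  by_cases hn : μ.degree = n
  · simp only [hn, if_true]
    rw [sum_antidiagonal_squarefree_neg_one_pow]
    have : n = 0 ∧ μ = 0 ↔ μ = 0 := by
      refine and_iff_right_of_imp ?_
      rintro rfl
      simpa using hn.symm
    simp only [this]
  · simp only [hn, if_false, Finset.sum_const_zero]
    rw [if_neg]
    rintro ⟨rfl, rfl⟩
    simp at hn

/-- The specialization of the generic symmetric functions to `Λ`. -/
noncomputable def specialize : MvPolynomial ℕ ℚ →ₐ[ℚ] Lam := MvPolynomial.aeval e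

theorem e_zero : e 0 = 1 := by
  classical
  refine Subtype.ext ?_
  ext μ
  have he : MvPowerSeries.coeff μ (e 0 : MvPowerSeries ℕ ℚ) =
      if μ.degree = 0 ∧ ∀ i, μ i ≤ 1 then 1 else 0 := by
    simp only [e]; rfl
  rw [he, OneMemClass.coe_one, MvPowerSeries.coeff_one]
  by_cases hμ : μ = 0 <;> simp [hμ, Finsupp.degree_eq_zero_iff]

theorem specialize_genericE (k : ℕ) : specialize (genericE k) = e k := by
  rw [genericE]
  split_ifs with hk
  · rw [hk, map_one, e_zero]
  · exact MvPolynomial.aeval_X _ _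

open PowerSeries in
-- Both sides are coefficients of the inverse of the same series, and inverses are unique.
theorem specialize_genericH (n : ℕ) : specialize (genericH n) = (-1) ^ n * h n := by
  have h1 := congrArg (PowerSeries.map (specialize : MvPolynomial ℕ ℚ →+* Lam))
    genericE_mul_genericHSeries
  have h2 : (PowerSeries.mk genericE).map (specialize : MvPolynomial ℕ ℚ →+* Lam) =
      PowerSeries.mk e := by
    ext1 k
    rw [coeff_map, coeff_mk, coeff_mk]
    exact specialize_genericE k
  rw [map_mul, map_one, h2, mul_comm] at h1
  have h3 := congrArg (coeff n) (left_inv_eq_right_inv h1 e_mul_h)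
  rw [coeff_map, coeff_mk] at h3
  exact h3

/-! ### Partitions into chains -/

/-- `IsSeq` for an arbitrary relation in place of the pairs of a given kind. -/
def IsChainSet (r : ℕ → ℕ → Prop) (n : ℕ) (s : Finset ℕ) : Prop :=
  s.Nonempty ∧ s ⊆ Finset.Icc 1 n ∧ (s.sort (· ≤ ·)).IsChain r

open Classical in
/-- `type` for an arbitrary relation in place of the pairs of a given kind. -/
noncomputable def chainType (r : ℕ → ℕ → Prop) (n : ℕ) : Multiset ℕ :=
  ((Finset.Icc 1 n).powerset.filter fun s => Maximal (IsChainSet r n) s).val.map Finset.card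

theorem type_eq_chainType (K : Kind) (n : ℕ) (θ : List ℕ) :
    type K n θ = chainType (IsPair K θ) n := rfl

/-- Consecutive elements of `s` are related by `r`. -/
def ConsecutiveRel (r : ℕ → ℕ → Prop) (s : Finset ℕ) : Prop :=
  ∀ a ∈ s, ∀ b ∈ s, a < b → (∀ c ∈ s, ¬(a < c ∧ c < b)) → r a b

theorem ConsecutiveRel.isChain_sort {r : ℕ → ℕ → Prop} {s : Finset ℕ} (h : ConsecutiveRel r s) :
    (s.sort (· ≤ ·)).IsChain r := by
  rw [List.isChain_iff_getElem]
  intro i hi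
  have hs : StrictMono (s.sort (· ≤ ·)).get := (Finset.sortedLT_sort s).strictMono_get
  refine h _ ((Finset.mem_sort _).1 (List.getElem_mem _)) _
    ((Finset.mem_sort _).1 (List.getElem_mem _)) (hs (a := ⟨i, by omega⟩) (b := ⟨i + 1, hi⟩)
      (Fin.mk_lt_mk.2 i.lt_succ_self)) ?_
  rintro c hc ⟨h1, h2⟩
  obtain ⟨j, hj, rfl⟩ := List.mem_iff_getElem.1 ((Finset.mem_sort (· ≤ ·)).2 hc)
  have h3 := (hs.lt_iff_lt (a := ⟨i, by omega⟩) (b := ⟨j, hj⟩)).1 h1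
  have h4 := (hs.lt_iff_lt (a := ⟨j, hj⟩) (b := ⟨i + 1, hi⟩)).1 h2
  rw [Fin.mk_lt_mk] at h3 h4
  omega

/-- A partition of `{1, …, n}` into chains of `r` such that related elements belong to the same
member. -/
structure IsChainPartition (r : ℕ → ℕ → Prop) (n : ℕ) (S : Finset (Finset ℕ)) : Prop where
  nonempty : ∀ s ∈ S, s.Nonempty
  cover : ∀ a, a ∈ Finset.Icc 1 n ↔ ∃ s ∈ S, a ∈ s
  unique : ∀ s ∈ S, ∀ t ∈ S, ∀ a, a ∈ s → a ∈ t → s = t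
  consecutive : ∀ s ∈ S, ConsecutiveRel r s
  closed : ∀ a b, r a b → ∀ s ∈ S, a ∈ s ↔ b ∈ s
  gap : ∀ a b, r a b → ∀ s ∈ S, a ∈ s → ∀ c ∈ s, ¬(a < c ∧ c < b)

/-- By `closed`, a chain that meets a member of `S` stays inside it; by `consecutive`, the members
are chains themselves. So they are exactly the maximal chains. -/
theorem IsChainPartition.chainType_eq {r : ℕ → ℕ → Prop} {n : ℕ} {S : Finset (Finset ℕ)}
    (hS : IsChainPartition r n S) : chainType r n = S.val.map Finset.card := by
  classical
  have hseq : ∀ s ∈ S, IsChainSet r n s := fun s hs =>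
    ⟨hS.nonempty s hs, fun a ha => (hS.cover a).2 ⟨s, hs, ha⟩, (hS.consecutive s hs).isChain_sort⟩
  have hsub : ∀ t, IsChainSet r n t → ∃ s ∈ S, t ⊆ s := by
    rintro t ⟨⟨a, ha⟩, hsubt, hc⟩
    obtain ⟨s, hs, has⟩ := (hS.cover a).1 (hsubt ha)
    refine ⟨s, hs, ?_⟩
    have hall : ∀ l : List ℕ, l.IsChain r → ∀ x ∈ l, ∀ y ∈ l, x ∈ s → y ∈ s := by
      intro l
      induction l with
      | nil => simp
      | cons u l ih =>
        intro hl
        cases l with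
        | nil =>
          intro x hx y hy hxs
          rw [List.mem_singleton] at hx hy
          rwa [hy, ← hx]
        | cons v l =>
          rw [List.isChain_cons_cons] at hl
          have huv := hS.closed u v hl.1 s hs
          have ih' := ih hl.2
          have key : ∀ y ∈ v :: l, (u ∈ s ↔ y ∈ s) := fun y hy =>
            huv.trans ⟨ih' v List.mem_cons_self y hy, ih' y hy v List.mem_cons_self⟩
          intro x hx y hy hxs
          have h1 : u ∈ s := by
            rcases List.mem_cons.1 hx with rfl | hx
            · exact hxs
            · exact (key x hx).2 hxs
          rcases List.mem_cons.1 hy with rfl | hy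
          · exact h1
          · exact (key y hy).1 h1
    intro b hb
    exact hall _ hc a ((Finset.mem_sort _).2 ha) b ((Finset.mem_sort _).2 hb) has
  rw [chainType]
  congr 2
  ext t
  rw [Finset.mem_filter, Finset.mem_powerset]
  constructor
  · rintro ⟨-, ht⟩
    obtain ⟨s, hs, hts⟩ := hsub t ht.prop
    rwa [hts.antisymm (ht.le_of_ge (hseq s hs) hts)]
  · intro ht
    refine ⟨(hseq t ht).2.1, hseq t ht, ?_⟩
    intro u hu htu
    obtain ⟨s, hs, hus⟩ := hsub u hu
    obtain ⟨a, ha⟩ := hS.nonempty t ht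
    rwa [hS.unique t ht s hs a ha (hus (htu ha))]

theorem isChainPartition_zero {r : ℕ → ℕ → Prop} (hr : ∀ a b, ¬r a b) :
    IsChainPartition r 0 ∅ :=
  ⟨by simp, by simp, by simp, by simp, fun a b h => (hr a b h).elim, by simp⟩

/-! ### Adding a largest element to a chain partition -/

section Extend

variable {r r' : ℕ → ℕ → Prop} {n : ℕ} {S : Finset (Finset ℕ)}

theorem IsChainPartition.le_of_mem (hS : IsChainPartition r n S) {s : Finset ℕ} (hs : s ∈ S)
    {a : ℕ} (ha : a ∈ s) : a ≤ n :=
  (Finset.mem_Icc.1 ((hS.cover a).2 ⟨s, hs, ha⟩)).2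

theorem IsChainPartition.singleton_notMem (hS : IsChainPartition r n S) : {n + 1} ∉ S := by
  intro h
  have := hS.le_of_mem h (Finset.mem_singleton_self _)
  omega

/-- A new largest element that is not related to anything is a chain by itself. -/
theorem IsChainPartition.insert_singleton (hS : IsChainPartition r n S)
    (h' : ∀ a b, r' a b ↔ r a b) (hr : ∀ a b, r a b → b ≤ n) (hlt : ∀ a b, r a b → a < b) :
    IsChainPartition r' (n + 1) (insert {n + 1} S) where
  nonempty := by
    intro s hs
    rcases Finset.mem_insert.1 hs with rfl | hs
    · exact Finset.singleton_nonempty _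
    · exact hS.nonempty s hs
  cover := by
    intro a
    have h := hS.cover a
    rw [Finset.mem_Icc] at h ⊢
    simp only [Finset.mem_insert, exists_eq_or_imp, Finset.mem_singleton, ← h]
    omega
  unique := by
    intro s hs t ht a has hat
    rcases Finset.mem_insert.1 hs with rfl | hs <;> rcases Finset.mem_insert.1 ht with rfl | ht
    · rfl
    · have := hS.le_of_mem ht hat
      rw [Finset.mem_singleton] at has
      omega
    · have := hS.le_of_mem hs has
      rw [Finset.mem_singleton] at hat
      omega
    · exact hS.unique s hs t ht a has hat
  consecutive := by
    intro s hs a ha b hb hab hc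
    rcases Finset.mem_insert.1 hs with rfl | hs
    · rw [Finset.mem_singleton] at ha hb
      omega
    · exact (h' a b).2 (hS.consecutive s hs a ha b hb hab hc)
  closed := by
    intro a b hab s hs
    have hab' := (h' a b).1 hab
    rcases Finset.mem_insert.1 hs with rfl | hs
    · have h1 := hr a b hab'
      have h2 := hlt a b hab'
      rw [Finset.mem_singleton, Finset.mem_singleton]
      omega
    · exact hS.closed a b hab' s hs
  gap := by
    intro a b hab s hs ha c hc
    have hab' := (h' a b).1 hab
    rcases Finset.mem_insert.1 hs with rfl | hs
    · have h1 := hr a b hab'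
      rw [Finset.mem_singleton] at ha hc
      omega
    · exact hS.gap a b hab' s hs ha c hc

/-- The chains obtained from `S` when a new largest element `m` is related to the element `x` of
the chain `s`, which loses its previous successor. -/
def splitChain (S : Finset (Finset ℕ)) (s : Finset ℕ) (x m : ℕ) : Finset (Finset ℕ) :=
  -- The upper part is empty when `x` is the largest element of `s`, hence the `erase ∅`.
  (insert (insert m (s.filter (· ≤ x))) (insert (s.filter (x < ·)) (S.erase s))).erase ∅

theorem mem_splitChain {s t : Finset ℕ} {x m : ℕ} :
    t ∈ splitChain S s x m ↔ t ≠ ∅ ∧ (t = insert m (s.filter (· ≤ x)) ∨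
      t = s.filter (x < ·) ∨ t ≠ s ∧ t ∈ S) := by
  simp only [splitChain, Finset.mem_erase, Finset.mem_insert]

theorem IsChainPartition.split (hS : IsChainPartition r n S) {s : Finset ℕ} (hs : s ∈ S) {x : ℕ}
    (hx : x ∈ s) (h' : ∀ a b, r' a b ↔ (a = x ∧ b = n + 1) ∨ (r a b ∧ a ≠ x))
    (hr : ∀ a b, r a b → b ≤ n) (hlt : ∀ a b, r a b → a < b) :
    IsChainPartition r' (n + 1) (splitChain S s x (n + 1)) where
  nonempty := fun t ht => Finset.nonempty_iff_ne_empty.2 (mem_splitChain.1 ht).1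
  cover := by
    intro a
    have h := hS.cover a
    rw [Finset.mem_Icc] at h ⊢
    constructor
    · rintro ⟨h1, h2⟩
      by_cases ha : a = n + 1
      · exact ⟨insert (n + 1) (s.filter (· ≤ x)),
          mem_splitChain.2 ⟨Finset.insert_ne_empty _ _, Or.inl rfl⟩, by simp [ha]⟩
      · obtain ⟨t, ht, hat⟩ := h.1 ⟨h1, by omega⟩
        by_cases hts : t = s
        · subst hts
          by_cases hax : a ≤ x
          · exact ⟨insert (n + 1) (t.filter (· ≤ x)),
              mem_splitChain.2 ⟨Finset.insert_ne_empty _ _, Or.inl rfl⟩, by simp [hat, hax]⟩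
          · have hmem : a ∈ t.filter (x < ·) := Finset.mem_filter.2 ⟨hat, by omega⟩
            exact ⟨_, mem_splitChain.2 ⟨Finset.ne_empty_of_mem hmem, Or.inr (Or.inl rfl)⟩, hmem⟩
        · exact ⟨t, mem_splitChain.2 ⟨Finset.ne_empty_of_mem hat, Or.inr (Or.inr ⟨hts, ht⟩)⟩, hat⟩
    · rintro ⟨t, ht, hat⟩
      rcases (mem_splitChain.1 ht).2 with rfl | rfl | ⟨-, ht⟩
      · rcases Finset.mem_insert.1 hat with rfl | hat
        · omega
        · have := h.2 ⟨s, hs, (Finset.mem_filter.1 hat).1⟩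
          omega
      · have := h.2 ⟨s, hs, (Finset.mem_filter.1 hat).1⟩
        omega
      · have := h.2 ⟨t, ht, hat⟩
        omega
  unique := by
    intro t ht u hu a hat hau
    have hle := fun (t : Finset ℕ) (ht : t ∈ S) (ha : a ∈ t) => hS.le_of_mem ht ha
    have huniq := fun (t u : Finset ℕ) (ht : t ∈ S) (hu : u ∈ S) hat hau =>
      hS.unique t ht u hu a hat hau
    rcases (mem_splitChain.1 ht).2 with rfl | rfl | ⟨hts, ht⟩ <;>
      rcases (mem_splitChain.1 hu).2 with rfl | rfl | ⟨hus, hu⟩ <;>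
      (try simp only [Finset.mem_insert, Finset.mem_filter] at hat hau) <;> grind
  consecutive := by
    intro t ht a ha b hb hab hc
    rw [h']
    rcases (mem_splitChain.1 ht).2 with rfl | rfl | ⟨hts, ht⟩
    · simp only [Finset.mem_insert, Finset.mem_filter] at ha hb hc
      rcases hb with rfl | ⟨hb, hbx⟩
      · rcases ha with rfl | ⟨ha, hax⟩
        · omega
        -- The element `x` lies in this member below `n + 1`, so the predecessor of `n + 1` can only
        -- be `x`.
        · have h1 := hc x (Or.inr ⟨hx, le_rfl⟩)
          have h2 := hS.le_of_mem hs hx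
          omega
      · have h2 := hS.le_of_mem hs hb
        rcases ha with rfl | ⟨ha, hax⟩
        · omega
        · refine Or.inr ⟨hS.consecutive s hs a ha b hb hab fun c hcs hcc => ?_, by omega⟩
          exact hc c (Or.inr ⟨hcs, by omega⟩) hcc
    · simp only [Finset.mem_filter] at ha hb hc
      refine Or.inr ⟨hS.consecutive s hs a ha.1 b hb.1 hab fun c hcs hcc => ?_, by omega⟩
      exact hc c ⟨hcs, by omega⟩ hcc
    · refine Or.inr ⟨hS.consecutive t ht a ha b hb hab hc, fun hax => ?_⟩
      exact hts (hS.unique t ht s hs a ha (hax ▸ hx))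
  closed := by
    intro a b hab t ht
    have hxn := hS.le_of_mem hs hx
    rcases (h' a b).1 hab with ⟨rfl, rfl⟩ | ⟨hab, hax⟩
    · rcases (mem_splitChain.1 ht).2 with rfl | rfl | ⟨hts, ht⟩
      · simp [hx]
      · have : n + 1 ∉ s := fun h => by have := hS.le_of_mem hs h; omega
        simp [this]
      · have h1 : n + 1 ∉ t := fun h => by have := hS.le_of_mem ht h; omega
        have h2 : a ∉ t := fun h => hts (hS.unique t ht s hs a h hx)
        simp [h1, h2]
    · have h1 := hr a b hab
      have h2 := hlt a b hab
      have h3 := hS.closed a b hab s hs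
      -- By `gap` no related pair straddles `x`, so the cut separates no pair other than the one
      -- starting at `x`.
      have h4 : a ∈ s → ¬(a < x ∧ x < b) := fun ha => hS.gap a b hab s hs ha x hx
      rcases (mem_splitChain.1 ht).2 with rfl | rfl | ⟨hts, ht⟩
      · simp only [Finset.mem_insert, Finset.mem_filter]
        grind
      · simp only [Finset.mem_filter]
        grind
      · exact hS.closed a b hab t ht
  gap := by
    intro a b hab t ht ha c hc
    have hxn := hS.le_of_mem hs hx
    rcases (h' a b).1 hab with ⟨rfl, rfl⟩ | ⟨hab, hax⟩
    · rcases (mem_splitChain.1 ht).2 with rfl | rfl | ⟨hts, ht⟩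
      · simp only [Finset.mem_insert, Finset.mem_filter] at hc
        omega
      · simp at ha
      · exact absurd (hS.unique t ht s hs a ha hx) hts
    · have h1 := hr a b hab
      have h2 := hlt a b hab
      have h4 := hS.gap a b hab s hs
      rcases (mem_splitChain.1 ht).2 with rfl | rfl | ⟨hts, ht⟩
      · simp only [Finset.mem_insert, Finset.mem_filter] at ha hc
        grind
      · simp only [Finset.mem_filter] at ha hc
        exact h4 ha.1 c hc.1
      · exact hS.gap a b hab t ht ha c hc

end Extend

/-! ### The weight of a relation -/

/-- The generic product `∏ e_{λ_i}` over the parts of `chainType r n`. -/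
noncomputable def chainWeight (r : ℕ → ℕ → Prop) (n : ℕ) : MvPolynomial ℕ ℚ :=
  ((chainType r n).map genericE).prod

theorem specialize_chainWeight (r : ℕ → ℕ → Prop) (n : ℕ) :
    specialize (chainWeight r n) = ePart (chainType r n) := by
  rw [chainWeight, ePart, map_multiset_prod, Multiset.map_map]
  simp only [Function.comp_def, specialize_genericE]

section Weight

variable {r : ℕ → ℕ → Prop} {n : ℕ} {S : Finset (Finset ℕ)}

theorem IsChainPartition.chainWeight_eq (hS : IsChainPartition r n S) :
    chainWeight r n = ∏ s ∈ S, genericE s.card := by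
  rw [chainWeight, hS.chainType_eq, Multiset.map_map]
  rfl

/-- Erasing an empty upper part is harmless because `genericE 0 = 1`. -/
theorem IsChainPartition.prod_splitChain (hS : IsChainPartition r n S) {s : Finset ℕ} (hs : s ∈ S)
    (x : ℕ) :
    ∏ t ∈ splitChain S s x (n + 1), genericE t.card =
      (∏ t ∈ S.erase s, genericE t.card) * (genericE ((s.filter (· ≤ x)).card + 1) *
        genericE (s.card - (s.filter (· ≤ x)).card)) := by
  have hn : n + 1 ∉ s := fun h => by have := hS.le_of_mem hs h; omega
  rw [splitChain, Finset.prod_erase _ (by simp [genericE_zero]), Finset.prod_insert,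
    Finset.prod_insert, Finset.card_insert_of_notMem]
  · have h := Finset.card_filter_add_card_filter_not (s := s) (· ≤ x)
    simp only [not_le] at h
    rw [← h, Nat.add_sub_cancel_left]
    ring
  · simp [hn]
  · intro h
    rw [Finset.mem_erase] at h
    obtain ⟨y, hy⟩ := hS.nonempty _ h.2
    exact h.1 (hS.unique _ h.2 s hs y hy (Finset.mem_filter.1 hy).1)
  · intro h
    have hmem := Finset.mem_insert_self (n + 1) (s.filter (· ≤ x))
    rcases Finset.mem_insert.1 h with h | h
    · rw [h] at hmem
      exact hn (Finset.mem_filter.1 hmem).1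
    · have := hS.le_of_mem (Finset.mem_of_mem_erase h) hmem
      omega

theorem derivation_prod {A R ι : Type*} [CommRing A] [CommRing R] [Algebra A R] [DecidableEq ι]
    (D : Derivation A R R) (s : Finset ι) (f : ι → R) :
    D (∏ i ∈ s, f i) = ∑ i ∈ s, (∏ j ∈ s.erase i, f j) • D (f i) := by
  induction s using Finset.induction_on with
  | empty => simp
  | insert a s ha ih =>
    rw [Finset.prod_insert ha, D.leibniz, Finset.sum_insert ha, Finset.erase_insert ha, ih,
      Finset.smul_sum, add_comm]
    congr 1
    refine Finset.sum_congr rfl fun i hi => ?_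
    rw [Finset.erase_insert_of_ne (ne_of_mem_of_not_mem hi ha).symm, Finset.prod_insert, mul_smul]
    exact fun h => ha (Finset.mem_of_mem_erase h)

/-- The rank of `x` in `s` takes each value from `1` to `s.card` once; this turns cut points into
the index of the sum defining `growth`. -/
theorem sum_card_filter_le {M : Type*} [AddCommMonoid M] (f : ℕ → M) (s : Finset ℕ) :
    ∑ x ∈ s, f (s.filter (· ≤ x)).card = ∑ j ∈ Finset.range s.card, f (j + 1) := by
  induction s using Finset.induction_on_max with
  | empty => simp
  | insert m s hm ih =>
    have hms : m ∉ s := fun h => lt_irrefl m (hm m h)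
    have h1 : (insert m s).filter (· ≤ m) = insert m s :=
      Finset.filter_true_of_mem fun y hy => by
        rcases Finset.mem_insert.1 hy with rfl | hy
        · exact le_rfl
        · exact (hm y hy).le
    rw [Finset.sum_insert hms, h1, Finset.card_insert_of_notMem hms, Finset.sum_range_succ,
      add_comm, ← ih]
    congr 1
    refine Finset.sum_congr rfl fun x hx => ?_
    rw [Finset.filter_insert, if_neg (not_le.2 (hm x hx))]

/-- The sum of the weights over all ways to relate a new largest element to an old one. -/
theorem IsChainPartition.sum_chainWeight (hS : IsChainPartition r n S)
    {r' : ℕ → ℕ → ℕ → Prop}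
    (h' : ∀ x ∈ Finset.Icc 1 n, ∀ a b, r' x a b ↔ (a = x ∧ b = n + 1) ∨ (r a b ∧ a ≠ x))
    (hr : ∀ a b, r a b → b ≤ n) (hlt : ∀ a b, r a b → a < b) :
    ∑ x ∈ Finset.Icc 1 n, chainWeight (r' x) (n + 1) = growth (chainWeight r n) := by
  have hcover : Finset.Icc 1 n = S.biUnion id := by
    ext a
    rw [hS.cover a, Finset.mem_biUnion]
    rfl
  have hdisj : (S : Set (Finset ℕ)).PairwiseDisjoint id := by
    intro s hs t ht hst
    rw [Function.onFun, Finset.disjoint_left]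
    intro a ha hat
    exact hst (hS.unique s hs t ht a ha hat)
  -- The Leibniz rule chooses the chain to be cut.
  have hleib : growth (∏ s ∈ S, genericE s.card) =
      ∑ s ∈ S, (∏ t ∈ S.erase s, genericE t.card) * growth (genericE s.card) := by
    simpa only [smul_eq_mul] using derivation_prod growth S fun s => genericE s.card
  rw [hS.chainWeight_eq, hleib]
  conv_lhs => rw [hcover]
  rw [Finset.sum_biUnion hdisj]
  refine Finset.sum_congr rfl fun s hs => ?_
  rw [growth_genericE, ← sum_card_filter_le (fun i => genericE (i + 1) * genericE (s.card - i)),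
    Finset.mul_sum]
  refine Finset.sum_congr rfl fun x hx => ?_
  rw [← hS.prod_splitChain hs x]
  exact (hS.split hs hx (h' x ((hS.cover x).2 ⟨s, hs, hx⟩)) hr hlt).chainWeight_eq

theorem IsChainPartition.chainWeight_insert_singleton (hS : IsChainPartition r n S)
    {r' : ℕ → ℕ → Prop} (h' : ∀ a b, r' a b ↔ r a b) (hr : ∀ a b, r a b → b ≤ n)
    (hlt : ∀ a b, r a b → a < b) :
    chainWeight r' (n + 1) = genericE 1 * chainWeight r n := by
  rw [(hS.insert_singleton h' hr hlt).chainWeight_eq, hS.chainWeight_eq,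
    Finset.prod_insert hS.singleton_notMem, Finset.card_singleton]

end Weight

/-! ### Stirling permutations and the insertion of the largest letter -/

/-- Stirling permutations described by letter counts and forbidden sublists. -/
def IsStirling (n : ℕ) (θ : List ℕ) : Prop :=
  (∀ x, θ.count x = if x ∈ Finset.Icc 1 n then 2 else 0) ∧
    ∀ x y, [x, y, x].Sublist θ → x ≤ y

theorem eq_Icc_add_Icc_iff (n : ℕ) (θ : List ℕ) :
    (Finset.Icc 1 n).val + (Finset.Icc 1 n).val = (θ : Multiset ℕ) ↔
      ∀ x, θ.count x = if x ∈ Finset.Icc 1 n then 2 else 0 := by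
  rw [Multiset.ext]
  refine forall_congr' fun x => ?_
  rw [Multiset.count_add, Multiset.coe_count, Multiset.count_eq_of_nodup (Finset.Icc 1 n).nodup,
    eq_comm]
  simp only [Finset.mem_val]
  split_ifs <;> rfl

/-- Sublists pass through insertion, deletion and reversal without index bookkeeping. -/
theorem mem_Q_iff {n : ℕ} {θ : List ℕ} : θ ∈ Q n ↔ IsStirling n θ := by
  rw [Q, Finset.mem_filter, Multiset.mem_toFinset, Multiset.mem_lists_iff]
  refine and_congr (eq_Icc_add_Icc_iff n θ) ⟨fun h x y hxy => ?_, fun h i j k hij hjk hik => ?_⟩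
  · obtain ⟨f, hf⟩ := List.sublist_iff_exists_fin_orderEmbedding_get_eq.1 hxy
    have h0 := hf (0 : Fin 3)
    have h1 := hf (1 : Fin 3)
    have h2 := hf (2 : Fin 3)
    have h01 : f (0 : Fin 3) < f (1 : Fin 3) := f.lt_iff_lt.2 (Fin.mk_lt_mk.2 (by norm_num))
    have h12 : f (1 : Fin 3) < f (2 : Fin 3) := f.lt_iff_lt.2 (Fin.mk_lt_mk.2 (by norm_num))
    have h3 := h _ _ _ h01 h12 (h0.symm.trans h2)
    rw [← h1, ← h2] at h3
    exact h3
  · have hs : [θ.get i, θ.get j, θ.get k].Sublist θ := by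
      have hmono : StrictMono (![i, j, k] : Fin 3 → Fin θ.length) := by
        rw [Fin.strictMono_iff_lt_succ]
        intro a
        fin_cases a
        · exact hij
        · exact hjk
      refine List.sublist_iff_exists_fin_orderEmbedding_get_eq.2
        ⟨OrderEmbedding.ofStrictMono _ hmono, fun a => ?_⟩
      change Fin 3 at a
      fin_cases a <;> rfl
    rw [hik] at hs
    exact h _ _ hs

theorem filter_ne_append_cons_cons {m : ℕ} {p q : List ℕ} (hp : m ∉ p) (hq : m ∉ q) :
    (p ++ m :: m :: q).filter (fun z => decide (z ≠ m)) = p ++ q := by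
  rw [List.filter_append, List.filter_cons_of_neg (by simp), List.filter_cons_of_neg (by simp)]
  congr 1
  · exact List.filter_eq_self.2 fun z hz => decide_eq_true (ne_of_mem_of_not_mem hz hp)
  · exact List.filter_eq_self.2 fun z hz => decide_eq_true (ne_of_mem_of_not_mem hz hq)

theorem idxOf_append_cons {m : ℕ} {p : List ℕ} (q : List ℕ) (hp : m ∉ p) :
    (p ++ m :: q).idxOf m = p.length := by
  rw [List.idxOf_append_of_notMem hp, List.idxOf_cons_self, add_zero]

namespace IsStirling

variable {n : ℕ} {θ : List ℕ}

theorem length_eq (h : IsStirling n θ) : θ.length = 2 * n := by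
  have h1 := congrArg Multiset.card ((eq_Icc_add_Icc_iff n θ).2 h.1)
  rw [Multiset.card_add, Finset.card_val, Nat.card_Icc, Multiset.coe_card] at h1
  omega

theorem mem_iff (h : IsStirling n θ) {x : ℕ} : x ∈ θ ↔ x ∈ Finset.Icc 1 n := by
  rw [← List.count_pos_iff, h.1]
  split_ifs with hx <;> simp [hx]

theorem le_of_mem (h : IsStirling n θ) {x : ℕ} (hx : x ∈ θ) : x ≤ n :=
  (Finset.mem_Icc.1 (h.mem_iff.1 hx)).2

theorem count_of_mem (h : IsStirling n θ) {x : ℕ} (hx : x ∈ θ) : θ.count x = 2 := by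
  rw [h.1, if_pos (h.mem_iff.1 hx)]

theorem count_le (h : IsStirling n θ) (x : ℕ) : θ.count x ≤ 2 := by
  rw [h.1]; split_ifs <;> simp

theorem succ_notMem (h : IsStirling n θ) : n + 1 ∉ θ := fun hm => by
  have := h.le_of_mem hm
  omega

theorem reverse (h : IsStirling n θ) : IsStirling n θ.reverse := by
  refine ⟨fun x => by rw [List.count_reverse, h.1], fun x y hxy => h.2 x y ?_⟩
  simpa using List.reverse_sublist.2 hxy

theorem insert_max {p q : List ℕ} (h : IsStirling n (p ++ q)) :
    IsStirling (n + 1) (p ++ (n + 1) :: (n + 1) :: q) := by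
  have hN : n + 1 ∉ p ++ q := h.succ_notMem
  rw [List.mem_append, not_or] at hN
  refine ⟨fun x => ?_, fun x y hxy => ?_⟩
  · have h1 := h.1 x
    rw [List.count_append] at h1 ⊢
    rw [List.count_cons, List.count_cons]
    simp only [Finset.mem_Icc] at h1 ⊢
    by_cases hx : n + 1 = x
    · subst hx
      simp only [beq_self_eq_true, if_true]
      rw [if_neg (by omega)] at h1
      rw [if_pos (by omega)]
      omega
    · simp only [beq_iff_eq, hx, if_false, add_zero]
      rw [h1]
      congr 1
      apply propext
      omega
  · have hy : y ∈ p ++ (n + 1) :: (n + 1) :: q := hxy.subset (by simp)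
    have hx : x ∈ p ++ (n + 1) :: (n + 1) :: q := hxy.subset (by simp)
    have hle : ∀ z ∈ p ++ (n + 1) :: (n + 1) :: q, z ≤ n + 1 := by
      intro z hz
      simp only [List.mem_append, List.mem_cons] at hz
      rcases hz with hz | hz | hz | hz
      · have := h.le_of_mem (List.mem_append_left q hz); omega
      · omega
      · omega
      · have := h.le_of_mem (List.mem_append_right p hz); omega
    by_contra hlt
    have hx1 := hle x hx
    by_cases hxN : x = n + 1
    · subst hxN
      obtain ⟨l₁, l₂, hl, hs₁, hs₂⟩ := List.sublist_append_iff.1 hxy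
      have hl₁ : l₁ = [] := by
        cases l₁ with
        | nil => rfl
        | cons a l₁ =>
          rw [List.cons_append, List.cons.injEq] at hl
          exact (hN.1 (hs₁.subset (by simp [hl.1]))).elim
      rw [hl₁, List.nil_append] at hl
      rw [← hl] at hs₂
      have hs₃ : [y, n + 1].Sublist ((n + 1) :: q) := List.cons_sublist_cons.1 hs₂
      rw [List.sublist_cons_iff] at hs₃
      rcases hs₃ with hs₃ | ⟨r, hr, -⟩
      · exact hN.2 (hs₃.subset (by simp))
      · rw [List.cons.injEq] at hr
        omega
    -- Here neither `x` nor `y < x` is `n + 1`, so the pattern survives the deletion of `n + 1`.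
    · have hf := hxy.filter (fun z => decide (z ≠ n + 1))
      have hyN : y ≠ n + 1 := by omega
      rw [filter_ne_append_cons_cons hN.1 hN.2, List.filter_eq_self.2 (by simp [hxN, hyN])] at hf
      exact hlt (h.2 x y hf)

theorem exists_eq_insert_max (h : IsStirling (n + 1) θ) :
    ∃ p q, θ = p ++ (n + 1) :: (n + 1) :: q ∧ IsStirling n (p ++ q) := by
  have hmem : n + 1 ∈ θ := h.mem_iff.2 (by simp)
  have hc := h.count_of_mem hmem
  obtain ⟨p, q', hθ, hp⟩ := List.eq_append_cons_of_mem hmem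
  have hcq : q'.count (n + 1) = 1 := by
    rw [hθ, List.count_append, List.count_eq_zero.2 hp, List.count_cons_self] at hc
    omega
  have hmem' : n + 1 ∈ q' := List.count_pos_iff.1 (by omega)
  obtain ⟨m, q, hq', hm⟩ := List.eq_append_cons_of_mem hmem'
  have hm_nil : m = [] := by
    by_contra hne
    obtain ⟨y, hy⟩ := List.exists_mem_of_ne_nil m hne
    have hsub : [n + 1, y, n + 1].Sublist θ := by
      rw [hθ, hq']
      refine List.Sublist.trans ?_ (List.sublist_append_right p _)
      refine List.Sublist.cons_cons _ ?_
      have : [y, n + 1] = [y] ++ [n + 1] := rfl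
      rw [this]
      exact (List.singleton_sublist.2 hy).append (List.singleton_sublist.2 List.mem_cons_self)
    have h1 := h.2 _ _ hsub
    have h2 := h.le_of_mem (hsub.subset (show y ∈ [n + 1, y, n + 1] by simp))
    exact hm ((le_antisymm h1 h2) ▸ hy)
  rw [hq', hm_nil, List.nil_append] at hθ
  refine ⟨p, q, hθ, fun x => ?_, fun x y hxy => h.2 x y (hxy.trans ?_)⟩
  · have h1 := h.1 x
    rw [hθ, List.count_append, List.count_cons, List.count_cons] at h1
    rw [List.count_append]
    simp only [Finset.mem_Icc] at h1 ⊢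
    by_cases hx : n + 1 = x
    · subst hx
      simp only [beq_self_eq_true, if_true] at h1
      rw [if_pos (by omega)] at h1
      rw [if_neg (by omega)]
      omega
    · simp only [beq_iff_eq, hx, if_false, add_zero] at h1
      rw [h1]
      congr 1
      apply propext
      omega
  · rw [hθ]
    exact (List.Sublist.refl p).append
      ((List.sublist_cons_self _ _).trans (List.sublist_cons_self _ _))

end IsStirling

/-- The word `θ` with two letters `m` inserted after the first `i` letters. -/
def insertTwice (m i : ℕ) (θ : List ℕ) : List ℕ := θ.take i ++ m :: m :: θ.drop i

/-- The inverse of the insertion deletes `n + 1` and records the position of its first copy. -/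
theorem sum_Q_succ {M : Type*} [AddCommMonoid M] (n : ℕ) (f : List ℕ → M) :
    ∑ θ ∈ Q (n + 1), f θ =
      ∑ θ ∈ Q n, ∑ i ∈ Finset.range (2 * n + 1), f (insertTwice (n + 1) i θ) := by
  rw [← Finset.sum_product']
  symm
  refine Finset.sum_nbij' (fun x => insertTwice (n + 1) x.2 x.1)
    (fun θ => (θ.filter (fun z => decide (z ≠ n + 1)), θ.idxOf (n + 1))) ?_ ?_ ?_ ?_ ?_
  · rintro ⟨θ, i⟩ hx
    rw [Finset.mem_product, mem_Q_iff] at hx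
    rw [mem_Q_iff]
    refine IsStirling.insert_max ?_
    rw [List.take_append_drop]
    exact hx.1
  · intro θ hθ
    obtain ⟨p, q, rfl, h⟩ := (mem_Q_iff.1 hθ).exists_eq_insert_max
    have hN := h.succ_notMem
    rw [List.mem_append, not_or] at hN
    have hl := h.length_eq
    rw [List.length_append] at hl
    rw [filter_ne_append_cons_cons hN.1 hN.2, idxOf_append_cons _ hN.1, Finset.mem_product, mem_Q_iff,
      Finset.mem_range]
    exact ⟨h, by dsimp only; omega⟩
  · rintro ⟨θ, i⟩ hx
    rw [Finset.mem_product, mem_Q_iff, Finset.mem_range] at hx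
    have hN := hx.1.succ_notMem
    have hl := hx.1.length_eq
    have h1 : n + 1 ∉ θ.take i := fun hm => hN (List.mem_of_mem_take hm)
    have h2 : n + 1 ∉ θ.drop i := fun hm => hN (List.mem_of_mem_drop hm)
    simp only at hl hx
    refine Prod.ext ?_ ?_
    · simp only [insertTwice]
      rw [filter_ne_append_cons_cons h1 h2, List.take_append_drop]
    · simp only [insertTwice]
      rw [idxOf_append_cons _ h1, List.length_take]
      omega
  · intro θ hθ
    obtain ⟨p, q, rfl, h⟩ := (mem_Q_iff.1 hθ).exists_eq_insert_max
    have hN := h.succ_notMem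
    rw [List.mem_append, not_or] at hN
    simp only [insertTwice]
    rw [filter_ne_append_cons_cons hN.1 hN.2, idxOf_append_cons _ hN.1, List.take_left, List.drop_left]
  · intro x _
    rfl

/-! ### The pairs of letters -/

/-- An occurrence of `a` is immediately followed by the first occurrence of `b > a`; the occurrence
of `a` is the second one if `β` holds and the first one otherwise. -/
def FollowedBy (β : Prop) (θ : List ℕ) (a b : ℕ) : Prop :=
  a < b ∧ ∃ p q, θ = p ++ a :: b :: q ∧ (a ∈ p ↔ β) ∧ b ∉ p

/-- The word `p` ends with the letter `a`, which occurs before if and only if `β` holds. -/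
def EndsWith (β : Prop) (p : List ℕ) (a : ℕ) : Prop :=
  ∃ p₀, p = p₀ ++ [a] ∧ (a ∈ p₀ ↔ β)

theorem EndsWith.eq {β : Prop} {p : List ℕ} {a b : ℕ} (ha : EndsWith β p a)
    (hb : EndsWith β p b) : a = b := by
  obtain ⟨p₀, h, -⟩ := ha
  obtain ⟨p₁, h', -⟩ := hb
  exact List.singleton_injective (List.append_inj_right' (h.symm.trans h') rfl)

/-- If one prefix were longer it would contain `x`, hence so would the shorter one, giving three
occurrences. -/
theorem prefix_eq_of_count_le_two {x : ℕ} {p q p' q' : List ℕ}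
    (h : p ++ x :: q = p' ++ x :: q') (hc : (p ++ x :: q).count x ≤ 2) (hx : x ∈ p ↔ x ∈ p') :
    p = p' := by
  have key : ∀ p q p' q' : List ℕ, p ++ x :: q = p' ++ x :: q' → (p ++ x :: q).count x ≤ 2 →
      (x ∈ p ↔ x ∈ p') → ∀ a, p' = p ++ a → p = p' := by
    rintro p q p' q' h hc hx a rfl
    rw [List.append_assoc, List.append_cancel_left_eq] at h
    cases a with
    | nil => rw [List.append_nil]
    | cons y a =>
      rw [List.cons_append, List.cons.injEq] at h
      obtain ⟨rfl, rfl⟩ := h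
      have h1 : x ∈ p := hx.2 (by simp)
      have h2 := List.count_pos_iff.2 h1
      simp only [List.count_append, List.count_cons_self] at hc
      omega
  rcases List.append_eq_append_iff.1 h with ⟨a, ha, -⟩ | ⟨a, ha, -⟩
  · exact key p q p' q' h hc hx a ha
  · exact (key p' q' p q h.symm (h ▸ hc) hx.symm a ha).symm

namespace IsStirling

variable {n : ℕ} {θ : List ℕ}

theorem isAAPair_iff (h : IsStirling n θ) (a b : ℕ) :
    IsAAPair θ a b ↔ FollowedBy True θ a b := by
  refine and_congr_right fun hab => ⟨?_, ?_⟩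
  · rintro ⟨p, u, v, q, rfl⟩
    refine ⟨p ++ a :: u, v ++ b :: q, by simp [block], by simp, fun hb => ?_⟩
    have hc := h.count_le b
    have := List.count_pos_iff.2 hb
    simp only [block, List.count_append, List.count_cons, List.count_nil, beq_self_eq_true,
      if_true] at hc this
    omega
  · rintro ⟨p, q, rfl, ha, hb⟩
    obtain ⟨p₁, u, rfl⟩ := List.append_of_mem (ha.2 trivial)
    have hc := h.count_of_mem (x := b) (by simp)
    have hbq : b ∈ q := by
      rw [List.count_append, List.count_eq_zero.2 hb, List.count_cons_of_ne (by omega),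
        List.count_cons_self] at hc
      exact List.count_pos_iff.1 (by omega)
    obtain ⟨v, q₁, rfl⟩ := List.append_of_mem hbq
    exact ⟨p₁, u, v, q₁, by simp [block]⟩

theorem isINPair_iff (h : IsStirling n θ) (a b : ℕ) :
    IsINPair θ a b ↔ FollowedBy False θ a b := by
  refine and_congr_right fun hab => ⟨?_, ?_⟩
  · rintro ⟨p, u, v, q, rfl⟩
    refine ⟨p, v ++ b :: (u ++ a :: q), by simp [block], iff_false_intro fun ha => ?_, fun hb => ?_⟩
    · have hc := h.count_le a
      have := List.count_pos_iff.2 ha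
      simp only [block, List.count_append, List.count_cons, List.count_nil, beq_self_eq_true,
        if_true] at hc this
      omega
    · have hc := h.count_le b
      have := List.count_pos_iff.2 hb
      simp only [block, List.count_append, List.count_cons, List.count_nil, beq_self_eq_true,
        if_true] at hc this
      omega
  · rintro ⟨p, q, rfl, ha, hb⟩
    have ha' : a ∉ p := ha.1
    have hcb := h.count_of_mem (x := b) (by simp)
    have hca := h.count_of_mem (x := a) (by simp)
    have hbq : b ∈ q := by
      rw [List.count_append, List.count_eq_zero.2 hb, List.count_cons_of_ne (by omega),
        List.count_cons_self] at hcb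
      exact List.count_pos_iff.1 (by omega)
    have haq : a ∈ q := by
      rw [List.count_append, List.count_eq_zero.2 ha', List.count_cons_self,
        List.count_cons_of_ne (by omega)] at hca
      exact List.count_pos_iff.1 (by omega)
    obtain ⟨v, q₁, rfl⟩ := List.append_of_mem hbq
    -- Otherwise `b a b` with `a < b` would occur; hence the block of `b` closes before that of `a`.
    have hav : a ∉ v := by
      intro hav
      have hsub : [b, a, b].Sublist (p ++ a :: b :: (v ++ b :: q₁)) := by
        refine List.Sublist.trans ?_ (List.sublist_append_right p _)
        refine List.Sublist.cons _ (List.Sublist.cons_cons _ ?_)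
        exact (List.singleton_sublist.2 hav).append
          (List.singleton_sublist.2 (List.mem_cons_self (a := b) (l := q₁)))
      have := h.2 _ _ hsub
      omega
    have haq₁ : a ∈ q₁ := by
      simp only [List.mem_append, List.mem_cons] at haq
      rcases haq with haq | haq | haq
      · exact (hav haq).elim
      · omega
      · exact haq
    obtain ⟨u, q₂, rfl⟩ := List.append_of_mem haq₁
    exact ⟨p, u, v, q₂, by simp [block]⟩

/-- Only the adjacency across the gap is destroyed, and `n + 1`, being largest, can only be the
second letter of a new pair. -/
theorem followedBy_insert_max (β : Prop) {p q : List ℕ} (h : IsStirling n (p ++ q)) (a b : ℕ) :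
    FollowedBy β (p ++ (n + 1) :: (n + 1) :: q) a b ↔
      (EndsWith β p a ∧ b = n + 1) ∨ (FollowedBy β (p ++ q) a b ∧ ¬EndsWith β p a) := by
  have h' := h.insert_max
  have hN := h.succ_notMem
  rw [List.mem_append, not_or] at hN
  constructor
  · rintro ⟨hab, p₁, q₁, he, ha, hb⟩
    by_cases hbN : b = n + 1
    · subst hbN
      have h1 : (p₁ ++ [a]) ++ (n + 1) :: q₁ = p ++ (n + 1) :: (n + 1) :: q := by
        rw [he]; simp
      have h2 := prefix_eq_of_count_le_two h1 (h1 ▸ h'.count_le (n + 1))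
        (iff_of_false (by simp [hb]; omega) hN.1)
      exact Or.inl ⟨⟨p₁, h2.symm, ha⟩, rfl⟩
    · have hb_le : b ≤ n + 1 := h'.le_of_mem (by rw [he]; simp)
      refine Or.inr ⟨⟨hab, p₁.filter (fun z => decide (z ≠ n + 1)),
        q₁.filter (fun z => decide (z ≠ n + 1)), ?_, ?_, ?_⟩, ?_⟩
      · rw [← filter_ne_append_cons_cons hN.1 hN.2, he, List.filter_append]
        simp [hbN, (show a ≠ n + 1 by omega)]
      · rw [← ha, List.mem_filter]
        exact and_iff_left (decide_eq_true (by omega))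
      · exact fun hm => hb (List.mem_of_mem_filter hm)
      · rintro ⟨p₀, rfl, hp₀⟩
        have h1 : p₀ ++ a :: ((n + 1) :: (n + 1) :: q) = p₁ ++ a :: (b :: q₁) := by
          rw [← he]; simp
        have h2 := prefix_eq_of_count_le_two h1
          (by rw [h1, ← he]; exact h'.count_le a) (hp₀.trans ha.symm)
        subst h2
        simp only [List.append_cancel_left_eq, List.cons.injEq, true_and] at h1
        exact hbN h1.1.symm
  · rintro (⟨⟨p₀, rfl, hp₀⟩, rfl⟩ | ⟨⟨hab, p₁, q₁, he, ha, hb⟩, hne⟩)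
    · have ha_le := h.le_of_mem (x := a) (by simp)
      refine ⟨by omega, p₀, (n + 1) :: q, by simp, hp₀, fun hm => hN.1 (by simp [hm])⟩
    · have haN : a ≠ n + 1 := by
        rintro rfl
        exact h.succ_notMem (by rw [he]; simp)
      have hbN : b ≠ n + 1 := by
        rintro rfl
        exact h.succ_notMem (by rw [he]; simp)
      refine ⟨hab, ?_⟩
      -- The gap lies before `a`, between `a` and `b`, or after `b`; `hne` excludes the middle case.
      rcases List.append_eq_append_iff.1 he with ⟨c, rfl, rfl⟩ | ⟨c, rfl, hc⟩
      · refine ⟨p ++ (n + 1) :: (n + 1) :: c, q₁, by simp, ?_, ?_⟩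
        · rw [← ha]; simp [haN]
        · simpa [hbN] using hb
      · rcases c with _ | ⟨x, _ | ⟨y, c⟩⟩
        · rw [List.nil_append] at hc
          refine ⟨p₁ ++ (n + 1) :: (n + 1) :: [], q₁, by simp [← hc], ?_, ?_⟩
          · rw [← ha]; simp [haN]
          · simpa [hbN] using hb
        · simp only [List.cons_append, List.nil_append, List.cons.injEq] at hc
          obtain ⟨rfl, hc⟩ := hc
          exact (hne ⟨p₁, rfl, ha⟩).elim
        · simp only [List.cons_append, List.cons.injEq] at hc
          obtain ⟨rfl, rfl, rfl⟩ := hc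
          exact ⟨p₁, c ++ (n + 1) :: (n + 1) :: q, by simp, ha, hb⟩

theorem le_of_followedBy (h : IsStirling n θ) {β : Prop} (a b : ℕ) (hab : FollowedBy β θ a b) :
    b ≤ n := by
  obtain ⟨-, p, q, rfl, -⟩ := hab
  exact h.le_of_mem (by simp)

theorem exists_isChainPartition (β : Prop) :
    ∀ {n : ℕ} {θ : List ℕ}, IsStirling n θ → ∃ S, IsChainPartition (FollowedBy β θ) n S
  | 0, θ, h => by
    refine ⟨∅, isChainPartition_zero fun a b hab => ?_⟩
    have h1 := h.le_of_followedBy a b hab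
    have h2 := hab.1
    omega
  | n + 1, θ, h => by
    obtain ⟨p, q, rfl, h'⟩ := h.exists_eq_insert_max
    obtain ⟨S, hS⟩ := exists_isChainPartition β h'
    have hrel := h'.followedBy_insert_max β
    by_cases hx : ∃ x, EndsWith β p x
    · obtain ⟨x, hx⟩ := hx
      have hmem : x ∈ p ++ q := by
        obtain ⟨p₀, rfl, -⟩ := hx
        simp
      obtain ⟨s, hs, hxs⟩ := (hS.cover x).1 (h'.mem_iff.1 hmem)
      have hiff : ∀ a, EndsWith β p a ↔ a = x := fun a =>
        ⟨fun ha => ha.eq hx, fun ha => ha ▸ hx⟩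
      simp only [hiff] at hrel
      exact ⟨_, hS.split hs hxs hrel h'.le_of_followedBy fun a b hab => hab.1⟩
    · rw [not_exists] at hx
      simp only [hx, false_and, false_or, not_false_eq_true, and_true] at hrel
      exact ⟨_, hS.insert_singleton hrel h'.le_of_followedBy fun a b hab => hab.1⟩

end IsStirling

/-! ### The recurrence for the weight enumerators -/

open Classical in
-- Each letter has exactly one occurrence of the kind selected by `β`. The entry at `i - 1` is the
-- letter before gap `i`; gap `0` is filtered out, so the default `0` is never read. Taking `v = 1`
-- counts these gaps.
theorem IsStirling.sum_endsWith {n : ℕ} {θ : List ℕ} (h : IsStirling n θ) (β : Prop)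
    {M : Type*} [AddCommMonoid M] (v : ℕ → M) :
    ∑ i ∈ (Finset.range (2 * n + 1)).filter (fun i => ∃ x, EndsWith β (θ.take i) x),
      v (θ.getD (i - 1) 0) = ∑ x ∈ Finset.Icc 1 n, v x := by
  have hpos : ∀ i ∈ (Finset.range (2 * n + 1)).filter (fun i => ∃ x, EndsWith β (θ.take i) x),
      ∃ p q x, i = p.length + 1 ∧ θ = p ++ x :: q ∧ (x ∈ p ↔ β) ∧ θ.getD (i - 1) 0 = x := by
    intro i hi
    rw [Finset.mem_filter, Finset.mem_range] at hi
    obtain ⟨hi, x, p, hp, hx⟩ := hi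
    have hl := congrArg List.length hp
    rw [List.length_take, h.length_eq, List.length_append, List.length_singleton] at hl
    have hθ : θ = p ++ x :: θ.drop i := by
      conv_lhs => rw [← List.take_append_drop i θ, hp]
      simp
    have hi' : i = p.length + 1 := by omega
    refine ⟨p, θ.drop i, x, hi', hθ, hx, ?_⟩
    rw [hθ, hi']
    simp
  refine Finset.sum_nbij (fun i => θ.getD (i - 1) 0) ?_ ?_ ?_ fun _ _ => rfl
  · intro i hi
    obtain ⟨p, q, x, -, hθ, -, hx⟩ := hpos i hi
    rw [hx, ← h.mem_iff, hθ]
    simp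
  · intro i hi j hj hij
    obtain ⟨p, q, x, rfl, hθ, hx, hix⟩ := hpos i hi
    obtain ⟨p', q', x', rfl, hθ', hx', hjx⟩ := hpos j hj
    have hxx : x = x' := by rw [← hix, ← hjx]; exact hij
    subst hxx
    rw [prefix_eq_of_count_le_two (hθ.symm.trans hθ') (hθ ▸ h.count_le x) (hx.trans hx'.symm)]
  · intro x hx
    have hxθ := h.mem_iff.2 hx
    have key : ∃ p q, θ = p ++ x :: q ∧ (x ∈ p ↔ β) := by
      obtain ⟨p, q, hθ, hp⟩ := List.eq_append_cons_of_mem hxθ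
      by_cases hβ : β
      · have hc := h.count_of_mem hxθ
        rw [hθ, List.count_append, List.count_eq_zero.2 hp, List.count_cons_self] at hc
        obtain ⟨m, q', hq⟩ := List.append_of_mem (List.count_pos_iff.1 (show 0 < q.count x by omega))
        exact ⟨p ++ x :: m, q', by rw [hθ, hq]; simp, by simp [hβ]⟩
      · exact ⟨p, q, hθ, iff_of_false hp hβ⟩
    obtain ⟨p, q, hθ, hp⟩ := key
    have hl := h.length_eq
    rw [hθ, List.length_append, List.length_cons] at hl
    refine ⟨p.length + 1, ?_, ?_⟩
    · rw [Finset.mem_coe, Finset.mem_filter, Finset.mem_range]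
      refine ⟨by omega, x, p, ?_, hp⟩
      rw [hθ, List.take_append]
      simp
    · rw [hθ]
      simp

/-- The `n` gaps after a selected occurrence cut a chain and produce `growth`; each of the remaining
`n + 1` contributes a factor `genericE 1`. -/
theorem IsStirling.sum_chainWeight_insertTwice {n : ℕ} {θ : List ℕ} (h : IsStirling n θ)
    (β : Prop) :
    ∑ i ∈ Finset.range (2 * n + 1),
        chainWeight (FollowedBy β (insertTwice (n + 1) i θ)) (n + 1) =
      (n + 1) * genericE 1 * chainWeight (FollowedBy β θ) n +
        growth (chainWeight (FollowedBy β θ) n) := by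
  classical
  obtain ⟨S, hS⟩ := h.exists_isChainPartition β
  have hrel : ∀ i a b, FollowedBy β (insertTwice (n + 1) i θ) a b ↔
      (EndsWith β (θ.take i) a ∧ b = n + 1) ∨ (FollowedBy β θ a b ∧ ¬EndsWith β (θ.take i) a) := by
    intro i a b
    have h1 : IsStirling n (θ.take i ++ θ.drop i) := by rwa [List.take_append_drop]
    have h2 := h1.followedBy_insert_max β a b
    rwa [List.take_append_drop] at h2
  have hlt : ∀ a b, FollowedBy β θ a b → a < b := fun a b hab => hab.1
  set r' : ℕ → ℕ → ℕ → Prop := fun x a b => (a = x ∧ b = n + 1) ∨ (FollowedBy β θ a b ∧ a ≠ x)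
  have hcard := h.sum_endsWith β (fun _ => 1)
  simp only [Finset.sum_const, smul_eq_mul, mul_one, Nat.card_Icc, Nat.add_sub_cancel] at hcard
  have hcard' := Finset.card_filter_add_card_filter_not (s := Finset.range (2 * n + 1))
    (fun i => ∃ x, EndsWith β (θ.take i) x)
  rw [hcard, Finset.card_range] at hcard'
  rw [← Finset.sum_filter_add_sum_filter_not _ (fun i => ∃ x, EndsWith β (θ.take i) x), add_comm]
  congr 1
  · rw [Finset.sum_congr rfl (g := fun _ => genericE 1 * chainWeight (FollowedBy β θ) n),
      Finset.sum_const, show Finset.card _ = n + 1 by omega, nsmul_eq_mul, mul_assoc]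
    · push_cast
      rfl
    · intro i hi
      have hx := (Finset.mem_filter.1 hi).2
      rw [not_exists] at hx
      refine hS.chainWeight_insert_singleton (fun a b => ?_) h.le_of_followedBy hlt
      rw [hrel]
      simp [hx]
  · rw [← hS.sum_chainWeight (r' := r') (fun x _ a b => Iff.rfl) h.le_of_followedBy hlt,
      ← h.sum_endsWith β]
    refine Finset.sum_congr rfl fun i hi => ?_
    obtain ⟨hi, x, hx⟩ := Finset.mem_filter.1 hi
    have hget : θ.getD (i - 1) 0 = x := by
      obtain ⟨p, hp, -⟩ := hx
      have hl := congrArg List.length hp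
      rw [Finset.mem_range] at hi
      rw [List.length_take, h.length_eq, List.length_append, List.length_singleton] at hl
      rw [← List.take_append_drop i θ, hp, show i - 1 = p.length by omega]
      simp
    have hiff : ∀ a, EndsWith β (θ.take i) a ↔ a = x := fun a =>
      ⟨fun ha => ha.eq hx, fun ha => ha ▸ hx⟩
    rw [hget]
    congr 1
    funext a b
    apply propext
    rw [hrel, hiff]

/-- The generic weight enumerator of the Stirling permutations of order `n`. -/
noncomputable def weightEnumerator (β : Prop) (n : ℕ) : MvPolynomial ℕ ℚ :=
  ∑ θ ∈ Q n, chainWeight (FollowedBy β θ) n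

theorem weightEnumerator_zero (β : Prop) : weightEnumerator β 0 = 1 := by
  have hQ : Q 0 = {[]} := by
    ext θ
    rw [mem_Q_iff, Finset.mem_singleton]
    constructor
    · intro h
      exact List.length_eq_zero_iff.1 h.length_eq
    · rintro rfl
      exact ⟨by simp, by simp⟩
  rw [weightEnumerator, hQ, Finset.sum_singleton, (isChainPartition_zero _).chainWeight_eq,
    Finset.prod_empty]
  rintro a b ⟨-, p, q, he, -⟩
  simp at he

theorem weightEnumerator_succ (β : Prop) (n : ℕ) :
    weightEnumerator β (n + 1) =
      (n + 1) * genericE 1 * weightEnumerator β n + growth (weightEnumerator β n) := by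
  rw [weightEnumerator, sum_Q_succ, weightEnumerator, map_sum, Finset.mul_sum,
    ← Finset.sum_add_distrib]
  exact Finset.sum_congr rfl fun θ hθ => (mem_Q_iff.1 hθ).sum_chainWeight_insertTwice β

/-! ### The four kinds -/

theorem block_reverse (a : ℕ) (w : List ℕ) : (block a w).reverse = block a w.reverse := by
  simp [block]

theorem isDAPair_iff_reverse (θ : List ℕ) (a b : ℕ) :
    IsDAPair θ a b ↔ IsAAPair θ.reverse a b := by
  refine and_congr_right fun _ => ⟨?_, ?_⟩
  · rintro ⟨p, u, v, q, rfl⟩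
    exact ⟨q.reverse, u.reverse, v.reverse, p.reverse, by simp [block_reverse]⟩
  · rintro ⟨p, u, v, q, he⟩
    rw [List.reverse_eq_iff] at he
    exact ⟨q.reverse, u.reverse, v.reverse, p.reverse, by simp [he, block_reverse]⟩

theorem isTNPair_iff_reverse (θ : List ℕ) (a b : ℕ) :
    IsTNPair θ a b ↔ IsINPair θ.reverse a b := by
  refine and_congr_right fun _ => ⟨?_, ?_⟩
  · rintro ⟨p, u, v, q, rfl⟩
    exact ⟨q.reverse, u.reverse, v.reverse, p.reverse, by simp [block_reverse]⟩
  · rintro ⟨p, u, v, q, he⟩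
    rw [List.reverse_eq_iff] at he
    exact ⟨q.reverse, u.reverse, v.reverse, p.reverse, by simp [he, block_reverse]⟩

theorem sum_Q_reverse {M : Type*} [AddCommMonoid M] (n : ℕ) (f : List ℕ → M) :
    ∑ θ ∈ Q n, f θ.reverse = ∑ θ ∈ Q n, f θ :=
  Finset.sum_nbij' List.reverse List.reverse
    (fun _ hθ => mem_Q_iff.2 (mem_Q_iff.1 hθ).reverse)
    (fun _ hθ => mem_Q_iff.2 (mem_Q_iff.1 hθ).reverse)
    (fun _ _ => List.reverse_reverse _) (fun _ _ => List.reverse_reverse _) fun _ _ => rfl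

/-- The occurrence of the smaller letter of a pair that faces the larger one, for each kind up to
reversal: the second one for adjacent pairs, the first one for nested pairs. -/
def Kind.IsAdjacent : Kind → Prop
  | Kind.AA => True
  | Kind.DA => True
  | Kind.TN => False
  | Kind.IN => False

theorem specialize_weightEnumerator (K : Kind) (n : ℕ) :
    specialize (weightEnumerator K.IsAdjacent n) = ∑ θ ∈ Q n, ePart (type K n θ) := by
  simp only [weightEnumerator, map_sum, specialize_chainWeight, type_eq_chainType]
  have hAA : ∀ θ ∈ Q n, IsPair Kind.AA θ = FollowedBy True θ := fun θ hθ => by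
    funext a b
    exact propext ((mem_Q_iff.1 hθ).isAAPair_iff a b)
  have hIN : ∀ θ ∈ Q n, IsPair Kind.IN θ = FollowedBy False θ := fun θ hθ => by
    funext a b
    exact propext ((mem_Q_iff.1 hθ).isINPair_iff a b)
  have hDA : ∀ θ, IsPair Kind.DA θ = IsPair Kind.AA θ.reverse := fun θ => by
    funext a b
    exact propext (isDAPair_iff_reverse θ a b)
  have hTN : ∀ θ, IsPair Kind.TN θ = IsPair Kind.IN θ.reverse := fun θ => by
    funext a b
    exact propext (isTNPair_iff_reverse θ a b)
  cases K with
  | AA => exact Finset.sum_congr rfl fun θ hθ => by rw [hAA θ hθ]; rfl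
  | IN => exact Finset.sum_congr rfl fun θ hθ => by rw [hIN θ hθ]; rfl
  | DA =>
    simp only [hDA]
    rw [sum_Q_reverse n fun θ => ePart (chainType (IsPair Kind.AA θ) n)]
    exact Finset.sum_congr rfl fun θ hθ => by rw [hAA θ hθ]; rfl
  | TN =>
    simp only [hTN]
    rw [sum_Q_reverse n fun θ => ePart (chainType (IsPair Kind.IN θ) n)]
    exact Finset.sum_congr rfl fun θ hθ => by rw [hIN θ hθ]; rfl

end StirlingSym

theorem mainTheorem1 (K : StirlingSym.Kind) :
    StirlingSym.IsCompInverse StirlingSym.hSeries (StirlingSym.stirlingSeries K) := by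
  have h := (StirlingSym.isCompInverse_generic (StirlingSym.weightEnumerator_zero K.IsAdjacent)
    (StirlingSym.weightEnumerator_succ K.IsAdjacent)).map
      (StirlingSym.specialize : MvPolynomial ℕ ℚ →+* StirlingSym.Lam)
  rw [StirlingSym.map_shiftedEgf, StirlingSym.map_shiftedEgf] at h
  simp only [StirlingSym.specialize_genericH, StirlingSym.specialize_weightEnumerator] at h
  -- Both series of the theorem unfold to `shiftedEgf`.
  exact h
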